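/- Let $\kappa>1$ and let $c:\mathbb R\to[\kappa^{-1},\kappa]$ be smooth with $\sup_v |c'(v)/(4c^2(v))|<\infty$. Let $u_0:\mathbb R\to\mathbb R$ be (locally) absolutely continuous with $(u_0)_x\in L^2(\mathbb R)$, and let $u_1\in L^2(\mathbb R)$. Put $R_0=u_1+c(u_0)(u_0)_x$, $S_0=u_1-c(u_0)(u_0)_x$, and let $\gamma=\{(X,Y): Y=\varphi(X)\}$ be the curve $$X(\bar x)=\int_0^{\bar x}(1+R_0^2)\,dy,\qquad Y(\bar x)=\int_{\bar x}^0(1+S_0^2)\,dy,\qquad \bar x\in\mathbb R .$$ Let $(w,z,p,q,u)$ be a solution on the whole $X$-$Y$ plane ($w,z,p,q$ measurable, $p,q$ locally bounded, $u$ continuous) of the system $$w_Y=\tfrac{c'}{8c^2}(\cos z-\cos w)q,\quad z_X=\tfrac{c'}{8c^2}(\cos w-\cos z)p,\quad p_Y=\tfrac{c'}{8c^2}(\sin z-\sin w)pq,\quad q_X=\tfrac{c'}{8c^2}(\sin w-\sin z)pq,$$ $$u_X=\tfrac{\sin w}{4c}\,p,\qquad u_Y=\tfrac{\sin z}{4c}\,q\qquad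 (c=c(u),\ c'=c'(u)),$$ in integral form, the equations for $w,p$ holding along almost every vertical line and those for $z,q$ along almost every horizontal line, with data $w=2\arctan R_0(\bar x)$, $z=2\arctan S_0(\bar x)$, $p=q=1$, $u=u_0(\bar x)$ at the point $(X(\bar x),Y(\bar x))$ of $\gamma$. This system is the variational wave equation $u_{tt}-c(u)\big(c(u)u_x\big)_x=0$, $u(0,\cdot)=u_0$, $u_t(0,\cdot)=u_1$, written in characteristic coordinates. Let $t(X,Y)$ and $x(X,Y)$ be obtained by integrating $t_Y=\frac{(1+\cos z)q}{4c}$ and $x_Y=-\frac{(1+\cos z)q}{4}$ from $\gamma$, where $t=0$ and $x=\bar x$ at $(X(\bar x),Y(\bar x))$. For $\tau\in\mathbb R$ let $\gamma_\tau$ be the boundary of $\{(X,Y): t(X,Y)\le\tau\}$, a curve oriented so that $X$ increases and $Y$ decreases, and let $\mu_\tau^-$ and $\mu_\tau^+$ be the positive measures on $\mathbb R$ which assign to a Borel set $B$ the integrals of $\frac{(1-\cos w)p}{8}\,dX$ and of $-\frac{(1-\cos z)q}{8}\,dY$, respectively, over the part of $\gamma_\tau$ where $x(X,Y)\in B$.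 Define the wave interaction potential $$\Lambda(t)=(\mu_t^-\otimes\mu_t^+)\big\{(x,y)\in\mathbb R^2: x>y\big\},\qquad t\in\mathbb R .$$ Then $\Lambda(t)$ is finite for every $t$, the map $t\mapsto\Lambda(t)$ has locally bounded variation on $\mathbb R$, and there is a constant $L_0$ such that $$\Lambda(t)-\Lambda(s)\le L_0\,(t-s)\qquad\text{for all real } t>s .$$ -/

import Mathlib

open MeasureTheory Set
open scoped ContDiff ENNReal

noncomputable section

namespace VariationalWave

/-! The variational wave equation `u_tt - c(u) (c(u) u_x)_x = 0` with data `u(0,·) = u0`,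
`u_t(0,·) = u1`, and its conservative solution through characteristic coordinates `(X, Y)`. -/

/-- The assumptions on the wave speed: `c` is smooth, takes values in `[κ⁻¹, κ]` with `κ > 1`,
and `sup |c' / (4 c²)|` is finite. -/
structure IsWaveSpeed (c : ℝ → ℝ) (κ : ℝ) : Prop where
  one_lt : 1 < κ
  smooth : ContDiff ℝ ∞ c
  lower : ∀ v, κ⁻¹ ≤ c v
  upper : ∀ v, c v ≤ κ
  bdd : BddAbove (range fun v => |deriv c v / (4 * c v ^ 2)|)

/-- The assumptions on the data: `u0` is (locally) absolutely continuous, with `(u0)_x ∈ L²`,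
and `u1 ∈ L²`. -/
structure IsWaveData (u0 u1 : ℝ → ℝ) : Prop where
  absCont : ∀ a b, AbsolutelyContinuousOnInterval u0 a b
  deriv_memLp : MemLp (deriv u0) 2 volume
  memLp : MemLp u1 2 volume

section InitialCurve

variable (c u0 u1 : ℝ → ℝ)

/-- `R(0,x) = u_t + c(u) u_x` at time zero. -/
def R0 (x : ℝ) : ℝ := u1 x + c (u0 x) * deriv u0 x

/-- `S(0,x) = u_t - c(u) u_x` at time zero. -/
def S0 (x : ℝ) : ℝ := u1 x - c (u0 x) * deriv u0 x

/-- First coordinate of the curve `γ` that represents the line `t = 0` in the `X`-`Y` plane. -/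
def curveX (x : ℝ) : ℝ := ∫ y in (0 : ℝ)..x, (1 + R0 c u0 u1 y ^ 2)

/-- Second coordinate of the curve `γ`. -/
def curveY (x : ℝ) : ℝ := ∫ y in x..(0 : ℝ), (1 + S0 c u0 u1 y ^ 2)

/-- The parameter `x` of the point of `γ` with first coordinate `X`
(`curveX` is a bijection of the line). -/
def footX (X : ℝ) : ℝ := Function.invFun (curveX c u0 u1) X

/-- The parameter `x` of the point of `γ` with second coordinate `Y`
(`curveY` is a bijection of the line). -/
def footY (Y : ℝ) : ℝ := Function.invFun (curveY c u0 u1) Y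

/-- The decreasing function `φ` whose graph `Y = φ(X)` is the curve `γ`. -/
def phi (X : ℝ) : ℝ := curveY c u0 u1 (footX c u0 u1 X)

/-- The inverse function of `φ`. -/
def phiInv (Y : ℝ) : ℝ := curveX c u0 u1 (footY c u0 u1 Y)

end InitialCurve

/-- `(w, z, p, q, u)` is a solution, on the whole `X`-`Y` plane, of the semilinear system
`w_Y = c'/(8c²) (cos z - cos w) q`,      `z_X = c'/(8c²) (cos w - cos z) p`,
`p_Y = c'/(8c²) (sin z - sin w) p q`,    `q_X = c'/(8c²) (sin w - sin z) p q`,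
`u_X = sin w / (4c) p`,                  `u_Y = sin z / (4c) q`,
with the data `w = 2 arctan R(0,x)`, `z = 2 arctan S(0,x)`, `p = q = 1`, `u = u0(x)` at the point
of `γ` of parameter `x`.  The equations are meant in integral form: those for `w, p` hold along
almost every vertical line, those for `z, q` along almost every horizontal line. -/
structure IsCharSolution (c u0 u1 : ℝ → ℝ) (w z p q u : ℝ → ℝ → ℝ) : Prop where
  measurable_w : Measurable (Function.uncurry w)
  measurable_z : Measurable (Function.uncurry z)
  measurable_p : Measurable (Function.uncurry p)
  measurable_q : Measurable (Function.uncurry q)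
  continuous_u : Continuous (Function.uncurry u)
  locally_bounded : ∀ r : ℝ, ∃ C : ℝ, ∀ X ∈ Icc (-r) r, ∀ Y ∈ Icc (-r) r,
    |p X Y| ≤ C ∧ |q X Y| ≤ C
  eq_w : ∀ᵐ X : ℝ, ∀ Y, w X Y = 2 * Real.arctan (R0 c u0 u1 (footX c u0 u1 X)) +
    ∫ Y' in (phi c u0 u1 X)..Y, deriv c (u X Y') / (8 * c (u X Y') ^ 2) *
      (Real.cos (z X Y') - Real.cos (w X Y')) * q X Y'
  eq_z : ∀ᵐ Y : ℝ, ∀ X, z X Y = 2 * Real.arctan (S0 c u0 u1 (footY c u0 u1 Y)) +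
    ∫ X' in (phiInv c u0 u1 Y)..X, deriv c (u X' Y) / (8 * c (u X' Y) ^ 2) *
      (Real.cos (w X' Y) - Real.cos (z X' Y)) * p X' Y
  eq_p : ∀ᵐ X : ℝ, ∀ Y, p X Y = 1 +
    ∫ Y' in (phi c u0 u1 X)..Y, deriv c (u X Y') / (8 * c (u X Y') ^ 2) *
      (Real.sin (z X Y') - Real.sin (w X Y')) * (p X Y' * q X Y')
  eq_q : ∀ᵐ Y : ℝ, ∀ X, q X Y = 1 +
    ∫ X' in (phiInv c u0 u1 Y)..X, deriv c (u X' Y) / (8 * c (u X' Y) ^ 2) *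
      (Real.sin (w X' Y) - Real.sin (z X' Y)) * (p X' Y * q X' Y)
  eq_u_Y : ∀ X Y, u X Y = u0 (footX c u0 u1 X) +
    ∫ Y' in (phi c u0 u1 X)..Y, Real.sin (z X Y') / (4 * c (u X Y')) * q X Y'
  eq_u_X : ∀ X Y, u X Y = u0 (footY c u0 u1 Y) +
    ∫ X' in (phiInv c u0 u1 Y)..X, Real.sin (w X' Y) / (4 * c (u X' Y)) * p X' Y

section Measures

variable (c u0 u1 : ℝ → ℝ) (w z p q u : ℝ → ℝ → ℝ)

/-- The time `t(X,Y)`: the integral of `t_Y = (1 + cos z) q / (4c)`, with `t = 0` on `γ`. -/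
def timeOf (X Y : ℝ) : ℝ :=
  ∫ Y' in (phi c u0 u1 X)..Y, (1 + Real.cos (z X Y')) * q X Y' / (4 * c (u X Y'))

/-- The position `x(X,Y)`: the integral of `x_Y = -(1 + cos z) q / 4`, where the point of `γ`
of parameter `x` has position `x`. -/
def posOf (X Y : ℝ) : ℝ :=
  footX c u0 u1 X - ∫ Y' in (phi c u0 u1 X)..Y, (1 + Real.cos (z X Y')) * q X Y' / 4

/-- The sublevel set `Γ_τ = {(X,Y) : t(X,Y) ≤ τ}`. -/
def sublevel (τ : ℝ) : Set (ℝ × ℝ) := {P | timeOf c u0 u1 z q u P.1 P.2 ≤ τ}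

/-- The highest point of `Γ_τ` on the vertical line of abscissa `X`.  As `t` is nondecreasing in
`X` and in `Y`, the boundary `γ_τ` of `Γ_τ` is a curve along which `X` increases and `Y` decreases;
up to vertical segments, which do not contribute to integrals in `dX`, it is the graph of
this function. -/
def upperY (τ X : ℝ) : ℝ := sSup {Y | (X, Y) ∈ sublevel c u0 u1 z q u τ}

/-- The rightmost point of `Γ_τ` on the horizontal line of ordinate `Y`; up to horizontal segments,
`γ_τ` is the graph `X = rightX τ Y`. -/
def rightX (τ Y : ℝ) : ℝ := sSup {X | (X, Y) ∈ sublevel c u0 u1 z q u τ}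

/-- The energy `μ_τ^-` of backward moving waves: the mass of a set `B` is the integral of
`(1 - cos w) p / 8 dX` over the part of the curve `γ_τ` where `x ∈ B`. -/
def muMinus (τ : ℝ) : Measure ℝ :=
  (volume.withDensity fun X => ENNReal.ofReal
      ((1 - Real.cos (w X (upperY c u0 u1 z q u τ X))) *
        p X (upperY c u0 u1 z q u τ X) / 8)).map
    fun X => posOf c u0 u1 z q X (upperY c u0 u1 z q u τ X)

/-- The energy `μ_τ^+` of forward moving waves: the mass of a set `B` is the integral of
`-(1 - cos z) q / 8 dY` over the part of the curve `γ_τ` where `x ∈ B`; here `γ_τ` is run through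
with `Y` decreasing, which makes it the integral of `(1 - cos z) q / 8` with respect to the Lebesgue
measure in `Y`. -/
def muPlus (τ : ℝ) : Measure ℝ :=
  (volume.withDensity fun Y => ENNReal.ofReal
      ((1 - Real.cos (z (rightX c u0 u1 z q u τ Y) Y)) *
        q (rightX c u0 u1 z q u τ Y) Y / 8)).map
    fun Y => posOf c u0 u1 z q (rightX c u0 u1 z q u τ Y) Y

/-- The wave interaction potential `Λ(t) = (μ_t^- ⊗ μ_t^+) {(x,y) : x > y}`. -/
def interactionPotential (t : ℝ) : ℝ≥0∞ :=
  ((muMinus c u0 u1 w z p q u t).prod (muPlus c u0 u1 z q u t)) {P : ℝ × ℝ | P.1 > P.2}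

end Measures

end VariationalWave

end

/-!
The solution is studied in the characteristic plane, where the two energies have the densities
`F = (1 - cos w) p / 8` (backward, with respect to `dX`) and `G = (1 - cos z) q / 8` (forward, with
respect to `dY`). The system gives `F_Y = h` and `G_X = -h` with one exchange term `h`, while
`α = t_X` and `β = t_Y` are nonnegative and have the same mixed derivative, so that `t` is
nondecreasing in both variables and can be integrated along either family of characteristics
(`CharSystem.T_eq`). The position `x` can be integrated along either family too, with
`x_X = c t_X` and `x_Y = -c t_Y` (`posOf_eq`).

Since the form `F dX - G dY` is closed, the energy on a curve of constant time is bounded by the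
energy `E` of the data (`CharSystem.lintegral_top_le`). Along a characteristic the length is
controlled by time and energy (`CharSystem.sub_mul_exp_le`), so every characteristic meets every
curve `t = τ`, and these curves are graphs `Y = top τ X` and `X = right τ Y`. A backward wave of
label `X` lies at time `τ` to the right of a forward wave of label `Y` exactly when their meeting
point is in the future, `τ < t(X, Y)` (`posOf_right_lt_posOf_top_iff`). Hence
(`interactionPotential_eq`, `CharSystem.potential_le_sq`)
`Λ(τ) = ∫∫_{t(X, Y) > τ} F(X, top τ X) G(right τ Y, Y) dX dY ≤ E²`.

When time passes from `s` to `t`, the potential loses the interaction in the strip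
`s < t(X, Y) ≤ t`, and it gains at most `2 E` times the integral of `|h|` over the strip, because
`F` and `G` change by integrals of `h` (`CharSystem.potential_add_lost_le`). The exchange is a
null form: from `|sin θ| ≤ η (1 - cos θ) + η⁻¹ (1 + cos θ)` one gets, with `ε` as small as desired,
`|h| ≤ ε F G + C (β F + α G)` (`CharSystem.abs_h_le`). The integral of `β` over a vertical section
of the strip is `t - s`, which makes the last term of order `E (t - s)`, up to the change of `F`
within the strip, that is, up to a multiple of the exchange itself. On short strips this multiple is
absorbed (`CharSystem.totalExchange_strip_le`), the term with `ε` is beaten by the loss, and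
`Λ(t) ≤ Λ(s) + L (t - s)` remains; long intervals are subdivided. Finally `L t - Λ(t)` is
nondecreasing, which gives the locally bounded variation.
-/

namespace VariationalWave

/-! ### Primitives of locally bounded functions -/

/-- A function on the line is locally bounded: it is bounded on each interval `[-r, r]`. -/
def LocBdd (g : ℝ → ℝ) : Prop := ∀ r : ℝ, ∃ C : ℝ, ∀ y ∈ Icc (-r) r, |g y| ≤ C

lemma LocBdd.mul {f g : ℝ → ℝ} (hf : LocBdd f) (hg : LocBdd g) :
    LocBdd fun y => f y * g y := by
  intro r
  obtain ⟨C, hC⟩ := hf r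
  obtain ⟨D, hD⟩ := hg r
  refine ⟨C * D, fun y hy => ?_⟩
  rw [abs_mul]
  exact mul_le_mul (hC y hy) (hD y hy) (abs_nonneg _) ((abs_nonneg _).trans (hC y hy))

lemma LocBdd.add {f g : ℝ → ℝ} (hf : LocBdd f) (hg : LocBdd g) :
    LocBdd fun y => f y + g y := by
  intro r
  obtain ⟨C, hC⟩ := hf r
  obtain ⟨D, hD⟩ := hg r
  exact ⟨C + D, fun y hy => (abs_add_le _ _).trans (add_le_add (hC y hy) (hD y hy))⟩

lemma LocBdd.of_continuous {f : ℝ → ℝ} (hf : Continuous f) : LocBdd f := by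
  intro r
  obtain ⟨C, hC⟩ := isCompact_Icc.exists_bound_of_continuousOn (s := Icc (-r) r) hf.continuousOn
  exact ⟨C, hC⟩

lemma LocBdd.exists_bound_uIcc {g : ℝ → ℝ} (hb : LocBdd g) (a b : ℝ) :
    ∃ C : ℝ, ∀ y ∈ uIcc a b, |g y| ≤ C := by
  obtain ⟨C, hC⟩ := hb (max |a| |b|)
  refine ⟨C, fun y hy => hC y ?_⟩
  have h1 := neg_abs_le a
  have h2 := neg_abs_le b
  have h3 := le_abs_self a
  have h4 := le_abs_self b
  have h5 := le_max_left |a| |b|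
  have h6 := le_max_right |a| |b|
  rcases mem_uIcc.1 hy with h | h <;> constructor <;> linarith [h.1, h.2]

lemma LocBdd.intervalIntegrable {g : ℝ → ℝ} (hm : Measurable g) (hb : LocBdd g) (a b : ℝ) :
    IntervalIntegrable g volume a b := by
  obtain ⟨C, hC⟩ := hb.exists_bound_uIcc a b
  rw [intervalIntegrable_iff]
  refine IntegrableOn.of_bound (by simp) hm.aestronglyMeasurable C ?_
  filter_upwards [ae_restrict_mem measurableSet_uIoc] with y hy
  exact hC y (uIoc_subset_uIcc hy)

/-- `f` is a primitive of the locally bounded measurable function `g`. -/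
structure IsPrimitive (f g : ℝ → ℝ) : Prop where
  measurable : Measurable g
  locBdd : LocBdd g
  sub_eq : ∀ a b, f b - f a = ∫ y in a..b, g y

namespace IsPrimitive

variable {f g f₁ g₁ f₂ g₂ : ℝ → ℝ}

lemma intervalIntegrable (h : IsPrimitive f g) (a b : ℝ) : IntervalIntegrable g volume a b :=
  h.locBdd.intervalIntegrable h.measurable a b

lemma congr {f' g' : ℝ → ℝ} (h : IsPrimitive f g) (hf : ∀ y, f' y = f y)
    (hg : ∀ y, g' y = g y) : IsPrimitive f' g' := by
  rwa [show f' = f from funext hf, show g' = g from funext hg]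

lemma of_base {f0 a : ℝ} (hm : Measurable g) (hb : LocBdd g)
    (h : ∀ y, f y = f0 + ∫ s in a..y, g s) : IsPrimitive f g := by
  refine ⟨hm, hb, fun x y => ?_⟩
  rw [h x, h y, ← intervalIntegral.integral_add_adjacent_intervals
    (hb.intervalIntegrable hm a x) (hb.intervalIntegrable hm x y)]
  ring

lemma absolutelyContinuous (h : IsPrimitive f g) (a b : ℝ) :
    AbsolutelyContinuousOnInterval f a b := by
  have h1 := (h.intervalIntegrable a b).absolutelyContinuousOnInterval_intervalIntegral
    (c := a) left_mem_uIcc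
  have h2 : AbsolutelyContinuousOnInterval (fun _ : ℝ => f a) a b :=
    (LipschitzWith.const (f a)).lipschitzOnWith.absolutelyContinuousOnInterval
  have e : (fun _ : ℝ => f a) + (fun x => ∫ v in a..x, g v) = f := by
    funext x
    simp [← h.sub_eq a x]
  exact e ▸ h2.add h1

lemma continuous (h : IsPrimitive f g) : Continuous f := by
  rw [continuous_iff_continuousAt]
  intro x
  have := (h.absolutelyContinuous (x - 1) (x + 1)).continuousOn
  rw [uIcc_of_le (by linarith)] at this
  exact this.continuousAt (Icc_mem_nhds (by linarith) (by linarith))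

lemma ae_hasDerivAt (h : IsPrimitive f g) : ∀ᵐ y, HasDerivAt f (g y) y := by
  have hl : LocallyIntegrable g volume := by
    rw [locallyIntegrable_iff]
    intro K hK
    obtain ⟨r, hr⟩ := hK.isBounded.subset_closedBall 0
    rw [Real.closedBall_eq_Icc] at hr
    refine IntegrableOn.mono_set ?_ hr
    rcases le_or_gt (0 - r) (0 + r) with h0 | h0
    · rw [integrableOn_Icc_iff_integrableOn_Ioc]
      exact (intervalIntegrable_iff_integrableOn_Ioc_of_le h0).1 (h.intervalIntegrable _ _)
    · rw [Icc_eq_empty_of_lt h0]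
      exact integrableOn_empty
  filter_upwards [_root_.LocallyIntegrable.ae_hasDerivAt_integral hl] with y hy
  have := (hy 0).const_add (f 0)
  have e : (fun x => f 0 + ∫ t in (0 : ℝ)..x, g t) = f := by
    funext x
    simp [← h.sub_eq 0 x]
  exact e ▸ this

lemma of_ae_hasDerivAt (hac : ∀ a b, AbsolutelyContinuousOnInterval f a b) (hm : Measurable g)
    (hb : LocBdd g) (hd : ∀ᵐ y, HasDerivAt f (g y) y) : IsPrimitive f g := by
  refine ⟨hm, hb, fun a b => ?_⟩
  rw [← (hac a b).integral_deriv_eq_sub]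
  refine intervalIntegral.integral_congr_ae ?_
  filter_upwards [hd] with y hy _ using hy.deriv

lemma mul (h₁ : IsPrimitive f₁ g₁) (h₂ : IsPrimitive f₂ g₂) :
    IsPrimitive (fun y => f₁ y * f₂ y) (fun y => g₁ y * f₂ y + f₁ y * g₂ y) := by
  have c₁ := h₁.continuous
  have c₂ := h₂.continuous
  refine of_ae_hasDerivAt
    (fun a b => (h₁.absolutelyContinuous a b).mul (h₂.absolutelyContinuous a b))
    ((h₁.measurable.mul c₂.measurable).add (c₁.measurable.mul h₂.measurable))
    ((h₁.locBdd.mul (.of_continuous c₂)).add ((LocBdd.of_continuous c₁).mul h₂.locBdd)) ?_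
  filter_upwards [h₁.ae_hasDerivAt, h₂.ae_hasDerivAt] with y h1 h2 using h1.mul h2

lemma const (k : ℝ) : IsPrimitive (fun _ => k) (fun _ => 0) :=
  ⟨measurable_const, fun _ => ⟨0, by simp⟩, by simp⟩

lemma comp {Φ : ℝ → ℝ} (hΦ : ContDiff ℝ 1 Φ) (h : IsPrimitive f g) :
    IsPrimitive (fun y => Φ (f y)) (fun y => deriv Φ (f y) * g y) := by
  have c := h.continuous
  have c' : Continuous fun y => deriv Φ (f y) := (hΦ.continuous_deriv (by simp)).comp c
  refine of_ae_hasDerivAt (fun a b => ?_) (c'.measurable.mul h.measurable)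
    ((LocBdd.of_continuous c').mul h.locBdd) ?_
  · obtain ⟨C, hC⟩ := h.locBdd.exists_bound_uIcc a b
    have hf : LipschitzOnWith C.toNNReal f (uIcc a b) := by
      refine LipschitzOnWith.of_dist_le_mul fun x hx y hy => ?_
      have hC0 : 0 ≤ C := (abs_nonneg _).trans (hC x hx)
      have hb : ∀ s ∈ uIoc y x, ‖g s‖ ≤ C := fun s hs =>
        hC s (uIcc_subset_uIcc hy hx (uIoc_subset_uIcc hs))
      rw [Real.dist_eq, Real.dist_eq, h.sub_eq, Real.coe_toNNReal _ hC0, ← Real.norm_eq_abs]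
      exact intervalIntegral.norm_integral_le_of_norm_le_const hb
    obtain ⟨r, hr⟩ := LocBdd.of_continuous c |>.exists_bound_uIcc a b
    obtain ⟨K, hK⟩ := (hΦ.contDiffOn (s := Icc (-r) r)).exists_lipschitzOnWith (by simp)
      (convex_Icc _ _) isCompact_Icc
    exact (hK.comp hf fun y hy => abs_le.1 (hr y hy)).absolutelyContinuousOnInterval
  · filter_upwards [h.ae_hasDerivAt] with y hy
    exact ((hΦ.differentiable (by simp)) (f y)).hasDerivAt.comp y hy

/-- A solution of the linear equation `f' = a f` with `f = 1` at `y₀` is an exponential. -/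
lemma eq_exp {a : ℝ → ℝ} {y₀ : ℝ} (hf : IsPrimitive f g) (ha : Measurable a) (hb : LocBdd a)
    (hg : ∀ y, g y = a y * f y) (h0 : f y₀ = 1) (y : ℝ) :
    f y = Real.exp (∫ s in y₀..y, a s) := by
  have hA : IsPrimitive (fun y => -∫ s in y₀..y, a s) (fun y => - a y) := by
    refine of_base (f0 := 0) (a := y₀) ha.neg (fun r => ?_) fun y => by simp
    obtain ⟨C, hC⟩ := hb r
    exact ⟨C, by simpa using hC⟩
  have hE := hA.comp (Φ := Real.exp) Real.contDiff_exp
  have h := (hf.mul hE).sub_eq y₀ y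
  have hz : ∀ s, g s * Real.exp (-∫ s in y₀..s, a s) +
      f s * (deriv Real.exp (-∫ s in y₀..s, a s) * -a s) = 0 := by
    intro s
    rw [hg, Real.deriv_exp]
    ring
  simp only [hz, intervalIntegral.integral_zero, h0, intervalIntegral.integral_same, neg_zero,
    Real.exp_zero, mul_one] at h
  rw [Real.exp_neg] at h
  field_simp at h
  linarith

end IsPrimitive

/-! ### Characteristic systems and their symmetries -/

/-- A function on the plane is locally bounded: it is bounded on each square `[-r, r]²`. -/
def LocBdd₂ (f : ℝ → ℝ → ℝ) : Prop :=
  ∀ r : ℝ, ∃ C : ℝ, ∀ X ∈ Icc (-r) r, ∀ Y ∈ Icc (-r) r, |f X Y| ≤ C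

lemma LocBdd₂.mul {f g : ℝ → ℝ → ℝ} (hf : LocBdd₂ f) (hg : LocBdd₂ g) :
    LocBdd₂ fun X Y => f X Y * g X Y := by
  intro r
  obtain ⟨C, hC⟩ := hf r
  obtain ⟨D, hD⟩ := hg r
  refine ⟨C * D, fun X hX Y hY => ?_⟩
  rw [abs_mul]
  exact mul_le_mul (hC X hX Y hY) (hD X hX Y hY) (abs_nonneg _)
    ((abs_nonneg _).trans (hC X hX Y hY))

lemma LocBdd₂.of_bound {f : ℝ → ℝ → ℝ} {C : ℝ} (h : ∀ X Y, |f X Y| ≤ C) : LocBdd₂ f :=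
  fun _ => ⟨C, fun X _ Y _ => h X Y⟩

lemma LocBdd₂.flip {f : ℝ → ℝ → ℝ} (hf : LocBdd₂ f) : LocBdd₂ fun X Y => f Y X := fun r =>
  let ⟨C, hC⟩ := hf r
  ⟨C, fun X hX Y hY => hC Y hY X hX⟩

lemma LocBdd₂.comp_neg {f : ℝ → ℝ → ℝ} (hf : LocBdd₂ f) : LocBdd₂ fun X Y => f (-X) (-Y) := by
  intro r
  obtain ⟨C, hC⟩ := hf r
  exact ⟨C, fun X hX Y hY => hC _ ⟨by linarith [hX.2], by linarith [hX.1]⟩ _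
    ⟨by linarith [hY.2], by linarith [hY.1]⟩⟩

lemma LocBdd₂.locBdd {f : ℝ → ℝ → ℝ} (hf : LocBdd₂ f) (X : ℝ) : LocBdd (f X) := by
  intro r
  obtain ⟨C, hC⟩ := hf (max |X| r)
  have h1 := le_max_left |X| r
  have h2 := le_max_right |X| r
  refine ⟨C, fun Y hY => hC X ?_ Y ⟨by linarith [hY.1], by linarith [hY.2]⟩⟩
  exact abs_le.1 h1

/-- A solution of the semilinear system in the characteristic plane, over an abstract base curve
`Y = φ X` (equivalently `X = ψ Y`), whose data are only required to have finite energy and to make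
the form `dt` consistent along the curve.  Unlike the concrete setting, this notion is stable
under the exchange of `X` and `Y` and under the reversal of time. -/
structure CharSystem where
  /-- the wave speed -/
  c : ℝ → ℝ
  /-- an upper bound of the wave speed -/
  κ : ℝ
  /-- an upper bound of `|c' / (8 c²)|` -/
  k₀ : ℝ
  /-- an upper bound of the energy on the base curve -/
  E : ℝ
  /-- the base curve as a graph over `X` -/
  φ : ℝ → ℝ
  /-- the base curve as a graph over `Y` -/
  ψ : ℝ → ℝ
  (w z p q u : ℝ → ℝ → ℝ)
  contDiff_c : ContDiff ℝ ∞ c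
  κ_pos : 0 < κ
  E_nonneg : 0 ≤ E
  c_ge : ∀ v, κ⁻¹ ≤ c v
  c_le : ∀ v, c v ≤ κ
  k_le : ∀ v, |deriv c v / (8 * c v ^ 2)| ≤ k₀
  lt_iff : ∀ X Y, φ X < Y ↔ ψ Y < X
  gt_iff : ∀ X Y, Y < φ X ↔ X < ψ Y
  measurable_w : Measurable (Function.uncurry w)
  measurable_z : Measurable (Function.uncurry z)
  measurable_p : Measurable (Function.uncurry p)
  measurable_q : Measurable (Function.uncurry q)
  continuous_u : Continuous (Function.uncurry u)
  locBdd_p : LocBdd₂ p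
  locBdd_q : LocBdd₂ q
  eq_w : ∀ᵐ X : ℝ, ∀ Y, w X Y = w X (φ X) +
    ∫ Y' in (φ X)..Y, deriv c (u X Y') / (8 * c (u X Y') ^ 2) *
      (Real.cos (z X Y') - Real.cos (w X Y')) * q X Y'
  eq_z : ∀ᵐ Y : ℝ, ∀ X, z X Y = z (ψ Y) Y +
    ∫ X' in (ψ Y)..X, deriv c (u X' Y) / (8 * c (u X' Y) ^ 2) *
      (Real.cos (w X' Y) - Real.cos (z X' Y)) * p X' Y
  eq_p : ∀ᵐ X : ℝ, ∀ Y, p X Y = 1 +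
    ∫ Y' in (φ X)..Y, deriv c (u X Y') / (8 * c (u X Y') ^ 2) *
      (Real.sin (z X Y') - Real.sin (w X Y')) * (p X Y' * q X Y')
  eq_q : ∀ᵐ Y : ℝ, ∀ X, q X Y = 1 +
    ∫ X' in (ψ Y)..X, deriv c (u X' Y) / (8 * c (u X' Y) ^ 2) *
      (Real.sin (w X' Y) - Real.sin (z X' Y)) * (p X' Y * q X' Y)
  eq_u_Y : ∀ X Y, u X Y = u X (φ X) +
    ∫ Y' in (φ X)..Y, Real.sin (z X Y') / (4 * c (u X Y')) * q X Y'
  eq_u_X : ∀ X Y, u X Y = u (ψ Y) Y +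
    ∫ X' in (ψ Y)..X, Real.sin (w X' Y) / (4 * c (u X' Y)) * p X' Y
  base_energy : (∫⁻ X, ENNReal.ofReal ((1 - Real.cos (w X (φ X))) * p X (φ X) / 8)) +
    (∫⁻ Y, ENNReal.ofReal ((1 - Real.cos (z (ψ Y) Y)) * q (ψ Y) Y / 8)) ≤ ENNReal.ofReal E
  base_time : ∀ X Y,
    ∫ X' in (ψ Y)..X, (1 + Real.cos (w X' (φ X'))) * p X' (φ X') / (4 * c (u X' (φ X'))) =
    ∫ Y' in (φ X)..Y, (1 + Real.cos (z (ψ Y') Y')) * q (ψ Y') Y' / (4 * c (u (ψ Y') Y'))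

lemma ae_comp_neg {P : ℝ → Prop} (h : ∀ᵐ x : ℝ, P x) : ∀ᵐ x : ℝ, P (-x) :=
  (Measure.measurePreserving_neg (volume : Measure ℝ)).quasiMeasurePreserving.ae h

namespace CharSystem

variable (S : CharSystem)

/-- The coefficient `c' / (8 c²)`. -/
noncomputable def k (X Y : ℝ) : ℝ := deriv S.c (S.u X Y) / (8 * S.c (S.u X Y) ^ 2)

/-- The density `(1 - cos w) p / 8` of the backward energy. -/
noncomputable def F (X Y : ℝ) : ℝ := (1 - Real.cos (S.w X Y)) * S.p X Y / 8

/-- The density `(1 - cos z) q / 8` of the forward energy. -/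
noncomputable def G (X Y : ℝ) : ℝ := (1 - Real.cos (S.z X Y)) * S.q X Y / 8

/-- The derivative `t_X`. -/
noncomputable def α (X Y : ℝ) : ℝ := (1 + Real.cos (S.w X Y)) * S.p X Y / (4 * S.c (S.u X Y))

/-- The derivative `t_Y`. -/
noncomputable def β (X Y : ℝ) : ℝ := (1 + Real.cos (S.z X Y)) * S.q X Y / (4 * S.c (S.u X Y))

/-- The exchange term between the two energies: `F_Y = h` and `G_X = -h`. -/
noncomputable def h (X Y : ℝ) : ℝ :=
  S.k X Y * (Real.sin (S.z X Y) * (1 - Real.cos (S.w X Y)) -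
    Real.sin (S.w X Y) * (1 - Real.cos (S.z X Y))) * (S.p X Y * S.q X Y) / 8

/-- The mixed second derivative of the time, `t_XY`. -/
noncomputable def timeXY (X Y : ℝ) : ℝ :=
  -(S.k X Y / (4 * S.c (S.u X Y))) * (Real.sin (S.z X Y) * (1 + Real.cos (S.w X Y)) +
    Real.sin (S.w X Y) * (1 + Real.cos (S.z X Y))) * (S.p X Y * S.q X Y)

/-- The mixed second derivative of the position, `x_XY`. -/
noncomputable def posXY (X Y : ℝ) : ℝ :=
  S.k X Y / 4 * (Real.sin (S.z X Y) * (1 + Real.cos (S.w X Y)) -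
    Real.sin (S.w X Y) * (1 + Real.cos (S.z X Y))) * (S.p X Y * S.q X Y)

/-- The time `t(X, Y)`. -/
noncomputable def T (X Y : ℝ) : ℝ := ∫ Y' in (S.φ X)..Y, S.β X Y'

/-- The exchange of the two families of characteristics. -/
@[simps]
def swap : CharSystem where
  c := S.c
  κ := S.κ
  k₀ := S.k₀
  E := S.E
  φ := S.ψ
  ψ := S.φ
  w X Y := S.z Y X
  z X Y := S.w Y X
  p X Y := S.q Y X
  q X Y := S.p Y X
  u X Y := S.u Y X
  contDiff_c := S.contDiff_c
  κ_pos := S.κ_pos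
  E_nonneg := S.E_nonneg
  c_ge := S.c_ge
  c_le := S.c_le
  k_le := S.k_le
  lt_iff X Y := (S.lt_iff Y X).symm
  gt_iff X Y := (S.gt_iff Y X).symm
  measurable_w := S.measurable_z.comp measurable_swap
  measurable_z := S.measurable_w.comp measurable_swap
  measurable_p := S.measurable_q.comp measurable_swap
  measurable_q := S.measurable_p.comp measurable_swap
  continuous_u := S.continuous_u.comp continuous_swap
  locBdd_p := S.locBdd_q.flip
  locBdd_q := S.locBdd_p.flip
  eq_w := S.eq_z
  eq_z := S.eq_w
  eq_p := by simpa only [mul_comm] using S.eq_q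
  eq_q := by simpa only [mul_comm] using S.eq_p
  eq_u_Y X Y := S.eq_u_X Y X
  eq_u_X X Y := S.eq_u_Y Y X
  base_energy := by rw [add_comm]; exact S.base_energy
  base_time X Y := (S.base_time Y X).symm

/-- The reversal of time. -/
@[simps]
def reflect : CharSystem where
  c := S.c
  κ := S.κ
  k₀ := S.k₀
  E := S.E
  φ X := -S.φ (-X)
  ψ Y := -S.ψ (-Y)
  w X Y := -S.w (-X) (-Y)
  z X Y := -S.z (-X) (-Y)
  p X Y := S.p (-X) (-Y)
  q X Y := S.q (-X) (-Y)
  u X Y := S.u (-X) (-Y)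
  contDiff_c := S.contDiff_c
  κ_pos := S.κ_pos
  E_nonneg := S.E_nonneg
  c_ge := S.c_ge
  c_le := S.c_le
  k_le := S.k_le
  lt_iff X Y := by rw [neg_lt, S.gt_iff, neg_lt]
  gt_iff X Y := by rw [lt_neg, S.lt_iff, lt_neg]
  measurable_w := (S.measurable_w.comp measurable_neg).neg
  measurable_z := (S.measurable_z.comp measurable_neg).neg
  measurable_p := S.measurable_p.comp measurable_neg
  measurable_q := S.measurable_q.comp measurable_neg
  continuous_u := S.continuous_u.comp continuous_neg
  locBdd_p := S.locBdd_p.comp_neg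
  locBdd_q := S.locBdd_q.comp_neg
  eq_w := by
    filter_upwards [ae_comp_neg S.eq_w] with X hX Y
    have := intervalIntegral.integral_comp_neg (a := -S.φ (-X)) (b := Y) fun Y' =>
      deriv S.c (S.u (-X) Y') / (8 * S.c (S.u (-X) Y') ^ 2) *
      (Real.cos (S.z (-X) Y') - Real.cos (S.w (-X) Y')) * S.q (-X) Y'
    simp only [Real.cos_neg, neg_neg] at this ⊢
    rw [this, hX (-Y), intervalIntegral.integral_symm]
    ring
  eq_z := by
    filter_upwards [ae_comp_neg S.eq_z] with Y hY X
    have := intervalIntegral.integral_comp_neg (a := -S.ψ (-Y)) (b := X) fun X' =>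
      deriv S.c (S.u X' (-Y)) / (8 * S.c (S.u X' (-Y)) ^ 2) *
      (Real.cos (S.w X' (-Y)) - Real.cos (S.z X' (-Y))) * S.p X' (-Y)
    simp only [Real.cos_neg, neg_neg] at this ⊢
    rw [this, hY (-X), intervalIntegral.integral_symm]
    ring
  eq_p := by
    filter_upwards [ae_comp_neg S.eq_p] with X hX Y
    have := intervalIntegral.integral_comp_neg (a := -S.φ (-X)) (b := Y) fun Y' =>
      deriv S.c (S.u (-X) Y') / (8 * S.c (S.u (-X) Y') ^ 2) *
      (-Real.sin (S.z (-X) Y') - -Real.sin (S.w (-X) Y')) * (S.p (-X) Y' * S.q (-X) Y')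
    simp only [Real.sin_neg, neg_neg] at this ⊢
    rw [this, hX (-Y), intervalIntegral.integral_symm, ← intervalIntegral.integral_neg]
    congr 2
    ext
    ring
  eq_q := by
    filter_upwards [ae_comp_neg S.eq_q] with Y hY X
    have := intervalIntegral.integral_comp_neg (a := -S.ψ (-Y)) (b := X) fun X' =>
      deriv S.c (S.u X' (-Y)) / (8 * S.c (S.u X' (-Y)) ^ 2) *
      (-Real.sin (S.w X' (-Y)) - -Real.sin (S.z X' (-Y))) * (S.p X' (-Y) * S.q X' (-Y))
    simp only [Real.sin_neg, neg_neg] at this ⊢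
    rw [this, hY (-X), intervalIntegral.integral_symm, ← intervalIntegral.integral_neg]
    congr 2
    ext
    ring
  eq_u_Y X Y := by
    have := intervalIntegral.integral_comp_neg (a := -S.φ (-X)) (b := Y) fun Y' =>
      -Real.sin (S.z (-X) Y') / (4 * S.c (S.u (-X) Y')) * S.q (-X) Y'
    simp only [Real.sin_neg, neg_neg] at this ⊢
    rw [this, S.eq_u_Y (-X) (-Y), intervalIntegral.integral_symm, ← intervalIntegral.integral_neg]
    congr 2
    ext
    ring
  eq_u_X X Y := by
    have := intervalIntegral.integral_comp_neg (a := -S.ψ (-Y)) (b := X) fun X' =>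
      -Real.sin (S.w X' (-Y)) / (4 * S.c (S.u X' (-Y))) * S.p X' (-Y)
    simp only [Real.sin_neg, neg_neg] at this ⊢
    rw [this, S.eq_u_X (-X) (-Y), intervalIntegral.integral_symm, ← intervalIntegral.integral_neg]
    congr 2
    ext
    ring
  base_energy := by
    have h1 := lintegral_neg_eq_self (μ := (volume : Measure ℝ)) fun X =>
      ENNReal.ofReal ((1 - Real.cos (S.w X (S.φ X))) * S.p X (S.φ X) / 8)
    have h2 := lintegral_neg_eq_self (μ := (volume : Measure ℝ)) fun Y =>
      ENNReal.ofReal ((1 - Real.cos (S.z (S.ψ Y) Y)) * S.q (S.ψ Y) Y / 8)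
    simp only [Real.cos_neg, neg_neg]
    rw [h1, h2]
    exact S.base_energy
  base_time X Y := by
    have h1 := intervalIntegral.integral_comp_neg (a := -S.ψ (-Y)) (b := X) fun X' =>
      (1 + Real.cos (S.w X' (S.φ X'))) * S.p X' (S.φ X') / (4 * S.c (S.u X' (S.φ X')))
    have h2 := intervalIntegral.integral_comp_neg (a := -S.φ (-X)) (b := Y) fun Y' =>
      (1 + Real.cos (S.z (S.ψ Y') Y')) * S.q (S.ψ Y') Y' / (4 * S.c (S.u (S.ψ Y') Y'))
    simp only [Real.cos_neg, neg_neg] at h1 h2 ⊢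
    rw [h1, h2, intervalIntegral.integral_symm, S.base_time, intervalIntegral.integral_symm]
    simp

lemma swap_k (X Y : ℝ) : S.swap.k X Y = S.k Y X := rfl
lemma swap_F (X Y : ℝ) : S.swap.F X Y = S.G Y X := rfl

lemma swap_h (X Y : ℝ) : S.swap.h X Y = -S.h Y X := by
  simp only [h, swap_k, swap_w, swap_z, swap_p, swap_q]
  ring

lemma swap_timeXY (X Y : ℝ) : S.swap.timeXY X Y = S.timeXY Y X := by
  simp only [timeXY, swap_k, swap_w, swap_z, swap_p, swap_q, swap_c, swap_u]
  ring

lemma swap_posXY (X Y : ℝ) : S.swap.posXY X Y = -S.posXY Y X := by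
  simp only [posXY, swap_k, swap_w, swap_z, swap_p, swap_q]
  ring

lemma reflect_F (X Y : ℝ) : S.reflect.F X Y = S.F (-X) (-Y) := by simp [F]
lemma reflect_β (X Y : ℝ) : S.reflect.β X Y = S.β (-X) (-Y) := by simp [β]

lemma reflect_T (X Y : ℝ) : S.reflect.T X Y = -S.T (-X) (-Y) := by
  have := intervalIntegral.integral_comp_neg (a := -S.φ (-X)) (b := Y) (S.β (-X))
  simp only [T, reflect_β, reflect_φ]
  rw [this, intervalIntegral.integral_symm, neg_neg]

end CharSystem

/-! ### Measurability and local bounds -/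

namespace CharSystem

variable (S : CharSystem)

lemma c_pos (v : ℝ) : 0 < S.c v := (inv_pos.2 S.κ_pos).trans_le (S.c_ge v)

lemma k₀_nonneg : 0 ≤ S.k₀ := (abs_nonneg _).trans (S.k_le 0)

lemma measurable_c : Measurable S.c := S.contDiff_c.continuous.measurable

lemma measurable_u : Measurable (Function.uncurry S.u) := S.continuous_u.measurable

lemma measurable_cu : Measurable (Function.uncurry fun X Y => S.c (S.u X Y)) :=
  S.measurable_c.comp S.measurable_u

lemma measurable_k : Measurable (Function.uncurry S.k) :=
  (((S.contDiff_c.continuous_deriv (by simp)).measurable).comp S.measurable_u).div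
    ((S.measurable_cu.pow_const 2).const_mul 8)

lemma measurable_F : Measurable (Function.uncurry S.F) :=
  ((measurable_const.sub (Real.measurable_cos.comp S.measurable_w)).mul
    S.measurable_p).div_const 8

lemma measurable_G : Measurable (Function.uncurry S.G) :=
  ((measurable_const.sub (Real.measurable_cos.comp S.measurable_z)).mul
    S.measurable_q).div_const 8

lemma measurable_α : Measurable (Function.uncurry S.α) :=
  ((measurable_const.add (Real.measurable_cos.comp S.measurable_w)).mul
    S.measurable_p).div (S.measurable_cu.const_mul 4)

lemma measurable_β : Measurable (Function.uncurry S.β) :=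
  ((measurable_const.add (Real.measurable_cos.comp S.measurable_z)).mul
    S.measurable_q).div (S.measurable_cu.const_mul 4)

lemma measurable_h : Measurable (Function.uncurry S.h) :=
  ((S.measurable_k.mul (((Real.measurable_sin.comp S.measurable_z).mul
    (measurable_const.sub (Real.measurable_cos.comp S.measurable_w))).sub
    ((Real.measurable_sin.comp S.measurable_w).mul
    (measurable_const.sub (Real.measurable_cos.comp S.measurable_z))))).mul
    (S.measurable_p.mul S.measurable_q)).div_const 8

lemma measurable_timeXY : Measurable (Function.uncurry S.timeXY) :=
  (((S.measurable_k.div (S.measurable_cu.const_mul 4)).neg).mul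
    (((Real.measurable_sin.comp S.measurable_z).mul
    (measurable_const.add (Real.measurable_cos.comp S.measurable_w))).add
    ((Real.measurable_sin.comp S.measurable_w).mul
    (measurable_const.add (Real.measurable_cos.comp S.measurable_z))))).mul
    (S.measurable_p.mul S.measurable_q)

lemma measurable_posXY : Measurable (Function.uncurry S.posXY) :=
  ((S.measurable_k.div_const 4).mul (((Real.measurable_sin.comp S.measurable_z).mul
    (measurable_const.add (Real.measurable_cos.comp S.measurable_w))).sub
    ((Real.measurable_sin.comp S.measurable_w).mul
    (measurable_const.add (Real.measurable_cos.comp S.measurable_z))))).mul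
    (S.measurable_p.mul S.measurable_q)

lemma abs_inv_c_le (v : ℝ) : |(4 * S.c v)⁻¹| ≤ S.κ := by
  have h := S.c_pos v
  have h2 := S.c_ge v
  rw [abs_of_pos (by positivity), mul_inv]
  have : (S.c v)⁻¹ ≤ S.κ := inv_le_of_inv_le₀ S.κ_pos h2
  have h3 : 0 < (S.c v)⁻¹ := by positivity
  linarith

lemma locBdd_k : LocBdd₂ S.k := .of_bound fun _ _ => S.k_le _

lemma locBdd_inv_c : LocBdd₂ fun X Y => (4 * S.c (S.u X Y))⁻¹ :=
  .of_bound fun _ _ => S.abs_inv_c_le _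

lemma abs_one_sub_cos_le (x : ℝ) : |1 - Real.cos x| ≤ 2 := by
  rw [abs_le]; constructor <;> linarith [Real.neg_one_le_cos x, Real.cos_le_one x]

lemma abs_one_add_cos_le (x : ℝ) : |1 + Real.cos x| ≤ 2 := by
  rw [abs_le]; constructor <;> linarith [Real.neg_one_le_cos x, Real.cos_le_one x]

lemma abs_sin_mul_le {x a : ℝ} (ha : |a| ≤ 2) : |Real.sin x * a| ≤ 2 := by
  rw [abs_mul]
  nlinarith [Real.abs_sin_le_one x, abs_nonneg a, abs_nonneg (Real.sin x)]

lemma locBdd_F : LocBdd₂ S.F := by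
  have := (LocBdd₂.of_bound (f := fun X Y => (1 - Real.cos (S.w X Y)) * 8⁻¹) (C := 2)
    fun X Y => by
      rw [abs_mul]
      have := abs_one_sub_cos_le (S.w X Y)
      norm_num
      linarith).mul S.locBdd_p
  convert! this using 3
  simp only [F]; ring

lemma locBdd_α : LocBdd₂ S.α := by
  have := ((LocBdd₂.of_bound (f := fun X Y => 1 + Real.cos (S.w X Y)) (C := 2)
    fun X Y => abs_one_add_cos_le _).mul S.locBdd_p).mul S.locBdd_inv_c
  exact this

lemma locBdd_β : LocBdd₂ S.β := S.swap.locBdd_α.flip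

lemma locBdd_pq : LocBdd₂ fun X Y => S.p X Y * S.q X Y := S.locBdd_p.mul S.locBdd_q

lemma locBdd_h : LocBdd₂ S.h := by
  have := (S.locBdd_k.mul (LocBdd₂.of_bound (f := fun X Y =>
    (Real.sin (S.z X Y) * (1 - Real.cos (S.w X Y)) -
    Real.sin (S.w X Y) * (1 - Real.cos (S.z X Y))) / 8) (C := 4) fun X Y => by
      rw [abs_div]
      have := abs_sub (Real.sin (S.z X Y) * (1 - Real.cos (S.w X Y)))
        (Real.sin (S.w X Y) * (1 - Real.cos (S.z X Y)))
      have h1 := abs_sin_mul_le (x := S.z X Y) (abs_one_sub_cos_le (S.w X Y))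
      have h2 := abs_sin_mul_le (x := S.w X Y) (abs_one_sub_cos_le (S.z X Y))
      norm_num
      linarith)).mul S.locBdd_pq
  convert! this using 3
  simp only [h]; ring

lemma locBdd_timeXY : LocBdd₂ S.timeXY := by
  have := ((S.locBdd_k.mul S.locBdd_inv_c).mul (LocBdd₂.of_bound (f := fun X Y =>
    -(Real.sin (S.z X Y) * (1 + Real.cos (S.w X Y)) +
    Real.sin (S.w X Y) * (1 + Real.cos (S.z X Y)))) (C := 4) fun X Y => by
      rw [abs_neg]
      have := abs_add_le (Real.sin (S.z X Y) * (1 + Real.cos (S.w X Y)))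
        (Real.sin (S.w X Y) * (1 + Real.cos (S.z X Y)))
      have h1 := abs_sin_mul_le (x := S.z X Y) (abs_one_add_cos_le (S.w X Y))
      have h2 := abs_sin_mul_le (x := S.w X Y) (abs_one_add_cos_le (S.z X Y))
      linarith)).mul S.locBdd_pq
  convert! this using 3
  simp only [timeXY]; ring

lemma locBdd_posXY : LocBdd₂ S.posXY := by
  have := (S.locBdd_k.mul (LocBdd₂.of_bound (f := fun X Y =>
    (Real.sin (S.z X Y) * (1 + Real.cos (S.w X Y)) -
    Real.sin (S.w X Y) * (1 + Real.cos (S.z X Y))) / 4) (C := 4) fun X Y => by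
      rw [abs_div]
      have := abs_sub (Real.sin (S.z X Y) * (1 + Real.cos (S.w X Y)))
        (Real.sin (S.w X Y) * (1 + Real.cos (S.z X Y)))
      have h1 := abs_sin_mul_le (x := S.z X Y) (abs_one_add_cos_le (S.w X Y))
      have h2 := abs_sin_mul_le (x := S.w X Y) (abs_one_add_cos_le (S.z X Y))
      norm_num
      linarith)).mul S.locBdd_pq
  convert! this using 3
  simp only [posXY]; ring

/-! ### The equations along vertical lines -/

lemma isPrimitive_w : ∀ᵐ X, IsPrimitive (S.w X) fun Y =>
    S.k X Y * (Real.cos (S.z X Y) - Real.cos (S.w X Y)) * S.q X Y := by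
  filter_upwards [S.eq_w] with X hX
  refine IsPrimitive.of_base ?_ ?_ hX
  · exact (((S.measurable_k.of_uncurry_left).mul ((Real.measurable_cos.comp
      S.measurable_z.of_uncurry_left).sub (Real.measurable_cos.comp
      S.measurable_w.of_uncurry_left))).mul S.measurable_q.of_uncurry_left)
  · refine ((S.locBdd_k.mul (LocBdd₂.of_bound
      (f := fun X Y => Real.cos (S.z X Y) - Real.cos (S.w X Y)) (C := 2)
      fun X Y => ?_)).mul S.locBdd_q).locBdd X
    rw [abs_le]
    constructor <;> linarith [Real.neg_one_le_cos (S.z X Y), Real.cos_le_one (S.z X Y),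
      Real.neg_one_le_cos (S.w X Y), Real.cos_le_one (S.w X Y)]

lemma locBdd_sub_sin : LocBdd₂ fun X Y => Real.sin (S.z X Y) - Real.sin (S.w X Y) :=
  .of_bound (C := 2) fun X Y => by
    rw [abs_le]
    constructor <;> linarith [Real.neg_one_le_sin (S.z X Y), Real.sin_le_one (S.z X Y),
      Real.neg_one_le_sin (S.w X Y), Real.sin_le_one (S.w X Y)]

lemma isPrimitive_p : ∀ᵐ X, IsPrimitive (S.p X) fun Y =>
    S.k X Y * (Real.sin (S.z X Y) - Real.sin (S.w X Y)) * (S.p X Y * S.q X Y) := by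
  filter_upwards [S.eq_p] with X hX
  refine IsPrimitive.of_base ?_ ?_ hX
  · exact (((S.measurable_k.of_uncurry_left).mul ((Real.measurable_sin.comp
      S.measurable_z.of_uncurry_left).sub (Real.measurable_sin.comp
      S.measurable_w.of_uncurry_left))).mul
      (S.measurable_p.of_uncurry_left.mul S.measurable_q.of_uncurry_left))
  · exact ((S.locBdd_k.mul S.locBdd_sub_sin).mul S.locBdd_pq).locBdd X

lemma isPrimitive_u (X : ℝ) : IsPrimitive (S.u X) fun Y =>
    Real.sin (S.z X Y) / (4 * S.c (S.u X Y)) * S.q X Y := by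
  refine IsPrimitive.of_base ?_ ?_ (S.eq_u_Y X)
  · exact ((Real.measurable_sin.comp S.measurable_z.of_uncurry_left).div
      (S.measurable_cu.of_uncurry_left.const_mul 4)).mul S.measurable_q.of_uncurry_left
  · exact (((LocBdd₂.of_bound (C := 1) fun X Y => Real.abs_sin_le_one _).mul
      S.locBdd_inv_c).mul S.locBdd_q).locBdd X

lemma isPrimitive_F : ∀ᵐ X, IsPrimitive (S.F X) (S.h X) := by
  filter_upwards [S.isPrimitive_w, S.isPrimitive_p] with X hw hp
  have hΦ : ContDiff ℝ 1 fun x => (1 - Real.cos x) / 8 := by fun_prop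
  have hd : ∀ x, deriv (fun x => (1 - Real.cos x) / 8) x = Real.sin x / 8 := fun x => by
    simp
  refine ((hw.comp hΦ).mul hp).congr (fun Y => ?_) fun Y => ?_
  · simp only [F]; ring
  · simp only [h, hd]; ring

lemma isPrimitive_cα : ∀ᵐ X,
    IsPrimitive (fun Y => (1 + Real.cos (S.w X Y)) * S.p X Y / 4) (S.posXY X) := by
  filter_upwards [S.isPrimitive_w, S.isPrimitive_p] with X hw hp
  have hΦ : ContDiff ℝ 1 fun x => (1 + Real.cos x) / 4 := by fun_prop
  have hd : ∀ x, deriv (fun x => (1 + Real.cos x) / 4) x = -Real.sin x / 4 := fun x => by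
    simp
  refine ((hw.comp hΦ).mul hp).congr (fun Y => ?_) fun Y => ?_
  · ring
  · simp only [posXY, hd]; ring

lemma isPrimitive_α : ∀ᵐ X, IsPrimitive (S.α X) (S.timeXY X) := by
  filter_upwards [S.isPrimitive_cα] with X hX
  have hΦ : ContDiff ℝ 1 fun v => (S.c v)⁻¹ :=
    (S.contDiff_c.of_le (by simp)).inv fun v => (S.c_pos v).ne'
  have hd : ∀ v, deriv (fun v => (S.c v)⁻¹) v = -deriv S.c v / S.c v ^ 2 := fun v =>
    (((S.contDiff_c.differentiable (by simp)) v).hasDerivAt.inv (S.c_pos v).ne').deriv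
  refine (hX.mul ((S.isPrimitive_u X).comp hΦ)).congr (fun Y => ?_) fun Y => ?_
  · have := (S.c_pos (S.u X Y)).ne'
    simp only [α]; field_simp
  · have := (S.c_pos (S.u X Y)).ne'
    simp only [timeXY, posXY, k, hd]; field_simp; ring

/-- Along almost every vertical line `p` is positive, being the exponential of an integral. -/
lemma p_eq_exp : ∀ᵐ X, ∀ Y, S.p X Y = Real.exp (∫ Y' in (S.φ X)..Y,
    S.k X Y' * (Real.sin (S.z X Y') - Real.sin (S.w X Y')) * S.q X Y') := by
  filter_upwards [S.isPrimitive_p, S.eq_p] with X hp h1 Y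
  refine hp.eq_exp ?_ ?_ (fun y => by ring) ?_ Y
  · exact (((S.measurable_k.of_uncurry_left).mul ((Real.measurable_sin.comp
      S.measurable_z.of_uncurry_left).sub (Real.measurable_sin.comp
      S.measurable_w.of_uncurry_left))).mul S.measurable_q.of_uncurry_left)
  · exact ((S.locBdd_k.mul S.locBdd_sub_sin).mul S.locBdd_q).locBdd X
  · simpa using h1 (S.φ X)

lemma p_pos : ∀ᵐ X, ∀ Y, 0 < S.p X Y := by
  filter_upwards [S.p_eq_exp] with X hX Y
  rw [hX]
  exact Real.exp_pos _

lemma q_pos : ∀ᵐ Y, ∀ X, 0 < S.q X Y := S.swap.p_pos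

lemma F_nonneg : ∀ᵐ X, ∀ Y, 0 ≤ S.F X Y := by
  filter_upwards [S.p_pos] with X hX Y
  have := hX Y
  have : 0 ≤ 1 - Real.cos (S.w X Y) := by linarith [Real.cos_le_one (S.w X Y)]
  simp only [F]
  positivity

lemma G_nonneg : ∀ᵐ Y, ∀ X, 0 ≤ S.G X Y := S.swap.F_nonneg

lemma α_nonneg : ∀ᵐ X, ∀ Y, 0 ≤ S.α X Y := by
  filter_upwards [S.p_pos] with X hX Y
  have := hX Y
  have := S.c_pos (S.u X Y)
  have : 0 ≤ 1 + Real.cos (S.w X Y) := by linarith [Real.neg_one_le_cos (S.w X Y)]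
  simp only [α]
  positivity

lemma β_nonneg : ∀ᵐ Y, ∀ X, 0 ≤ S.β X Y := S.swap.α_nonneg

/-! ### Closed forms -/

lemma antitone_φ : Antitone S.φ := fun X X' h => by
  by_contra! hlt
  exact absurd ((S.lt_iff X (S.φ X')).1 hlt)
    (not_lt.2 (h.trans (not_lt.1 fun hh => lt_irrefl _ ((S.lt_iff X' (S.φ X')).2 hh))))

lemma antitone_ψ : Antitone S.ψ := S.swap.antitone_φ

lemma le_iff (X Y : ℝ) : S.φ X ≤ Y ↔ S.ψ Y ≤ X := by
  rw [← not_lt, ← not_lt, S.gt_iff]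

lemma measurable_φ : Measurable S.φ := S.antitone_φ.measurable

lemma _root_.VariationalWave.LocBdd₂.integrableOn {m : ℝ → ℝ → ℝ}
    (hm : Measurable (Function.uncurry m)) (hb : LocBdd₂ m) (a b c d : ℝ) :
    IntegrableOn (Function.uncurry m) (Icc a b ×ˢ Icc c d) := by
  obtain ⟨C, hC⟩ := hb (|a| + |b| + |c| + |d|)
  refine IntegrableOn.of_bound ?_ hm.aestronglyMeasurable C ?_
  · rw [Measure.volume_eq_prod, Measure.prod_prod]
    exact ENNReal.mul_lt_top (by simp) (by simp)
  · filter_upwards [ae_restrict_mem (measurableSet_Icc.prod measurableSet_Icc)]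
    rintro ⟨x, y⟩ ⟨⟨h1, h2⟩, h3, h4⟩
    have := abs_le.1 (le_refl |a|)
    have := abs_le.1 (le_refl |b|)
    have := abs_le.1 (le_refl |c|)
    have := abs_le.1 (le_refl |d|)
    have := abs_nonneg a
    have := abs_nonneg b
    have := abs_nonneg c
    have := abs_nonneg d
    simp only at h1 h2 h3 h4
    exact hC x ⟨by linarith, by linarith⟩ y ⟨by linarith, by linarith⟩

variable {m : ℝ → ℝ → ℝ}

lemma fubini_above (hm : Measurable (Function.uncurry m)) (hb : LocBdd₂ m) {X Y : ℝ}
    (hXY : S.φ X ≤ Y) :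
    ∫ X' in (S.ψ Y)..X, ∫ Y' in (S.φ X')..Y, m X' Y' =
      ∫ Y' in (S.φ X)..Y, ∫ X' in (S.ψ Y')..X, m X' Y' := by
  classical
  have hYX := (S.le_iff X Y).1 hXY
  have e1 : ∀ X' ∈ uIcc (S.ψ Y) X, ∫ Y' in (S.φ X')..Y, m X' Y' =
      ∫ Y' in (S.φ X)..Y, if S.φ X' < Y' then m X' Y' else 0 := by
    intro X' hX'
    rw [uIcc_of_le hYX] at hX'
    have h1 : S.φ X' ≤ Y := (S.le_iff _ _).2 hX'.1
    have h2 : S.φ X ≤ S.φ X' := S.antitone_φ hX'.2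
    rw [intervalIntegral.integral_of_le h1, intervalIntegral.integral_of_le hXY]
    have : (fun Y' => if S.φ X' < Y' then m X' Y' else 0) = (Ioi (S.φ X')).indicator (m X') := by
      ext Y'; simp [indicator]
    rw [this, setIntegral_indicator measurableSet_Ioi]
    congr 2
    ext y
    simp only [mem_Ioc, mem_inter_iff, mem_Ioi]
    grind
  have e2 : ∀ Y' ∈ uIcc (S.φ X) Y, ∫ X' in (S.ψ Y')..X, m X' Y' =
      ∫ X' in (S.ψ Y)..X, if S.φ X' < Y' then m X' Y' else 0 := by
    intro Y' hY'
    rw [uIcc_of_le hXY] at hY'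
    have h1 : S.ψ Y' ≤ X := (S.le_iff _ _).1 hY'.1
    have h2 : S.ψ Y ≤ S.ψ Y' := S.antitone_ψ hY'.2
    rw [intervalIntegral.integral_of_le h1, intervalIntegral.integral_of_le hYX]
    have : (fun X' => if S.φ X' < Y' then m X' Y' else 0) =
        (Ioi (S.ψ Y')).indicator (fun X' => m X' Y') := by
      ext X'; simp [indicator, S.lt_iff]
    rw [this, setIntegral_indicator measurableSet_Ioi]
    congr 2
    ext y
    simp only [mem_Ioc, mem_inter_iff, mem_Ioi]
    grind
  rw [intervalIntegral.integral_congr e1, intervalIntegral.integral_congr e2]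
  refine intervalIntegral_intervalIntegral_swap ?_
  have hms : MeasurableSet {P : ℝ × ℝ | S.φ P.1 < P.2} :=
    measurableSet_lt (S.measurable_φ.comp measurable_fst) measurable_snd
  have := ((hb.integrableOn hm (S.ψ Y) X (S.φ X) Y).indicator hms)
  rw [uIoc_of_le hYX, uIoc_of_le hXY]
  refine (this.mono_set (prod_mono Ioc_subset_Icc_self Ioc_subset_Icc_self)).congr ?_
  refine .of_forall ?_
  rintro ⟨x, y⟩
  simp [indicator]

/-- Fubini's theorem on the triangle between the base curve and the point `(X, Y)`, which may lie
on either side of the curve. -/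
lemma fubini (hm : Measurable (Function.uncurry m)) (hb : LocBdd₂ m) (X Y : ℝ) :
    ∫ X' in (S.ψ Y)..X, ∫ Y' in (S.φ X')..Y, m X' Y' =
      ∫ Y' in (S.φ X)..Y, ∫ X' in (S.ψ Y')..X, m X' Y' := by
  rcases le_total (S.φ X) Y with h | h
  · exact S.fubini_above hm hb h
  · have h' : S.reflect.φ (-X) ≤ -Y := by simpa using h
    have key := S.reflect.fubini_above (m := fun X Y => m (-X) (-Y)) (hm.comp measurable_neg)
      hb.comp_neg h'
    have i1 : ∀ a b x, ∫ Y' in a..b, m x (-Y') = ∫ Y' in (-b)..(-a), m x Y' :=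
      fun a b x => intervalIntegral.integral_comp_neg (m x)
    have i2 : ∀ a b y, ∫ X' in a..b, m (-X') y = ∫ X' in (-b)..(-a), m X' y :=
      fun a b y => intervalIntegral.integral_comp_neg (fun x => m x y)
    simp only [i1, i2, reflect_φ, reflect_ψ, neg_neg] at key
    rw [intervalIntegral.integral_comp_neg (fun X' => ∫ Y' in Y..(S.φ X'), m X' Y'),
      intervalIntegral.integral_comp_neg (fun Y' => ∫ X' in X..(S.ψ Y'), m X' Y')] at key
    simp only [neg_neg] at key
    rw [intervalIntegral.integral_symm X (S.ψ Y), intervalIntegral.integral_symm Y (S.φ X)]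
    have s1 : ∀ x, ∫ Y' in (S.φ x)..Y, m x Y' = -∫ Y' in Y..(S.φ x), m x Y' :=
      fun x => intervalIntegral.integral_symm _ _
    have s2 : ∀ y, ∫ X' in (S.ψ y)..X, m X' y = -∫ X' in X..(S.ψ y), m X' y :=
      fun y => intervalIntegral.integral_symm _ _
    simp only [s1, s2, intervalIntegral.integral_neg, key]

/-- If `f_Y = g_X = m`, then the form `f dX + g dY` is closed: its integrals along the horizontal
and the vertical sides of the triangle below `(X, Y)` differ by its integral along the base
curve. -/
lemma closed_form (hm : Measurable (Function.uncurry m)) (hb : LocBdd₂ m) {f g : ℝ → ℝ → ℝ}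
    (hf : ∀ᵐ X, IsPrimitive (f X) (m X)) (hg : ∀ᵐ Y, IsPrimitive (fun X => g X Y) fun X => m X Y)
    (X Y : ℝ) :
    ∫ X' in (S.ψ Y)..X, (f X' Y - f X' (S.φ X')) =
      ∫ Y' in (S.φ X)..Y, (g X Y' - g (S.ψ Y') Y') := by
  have e1 : ∫ X' in (S.ψ Y)..X, (f X' Y - f X' (S.φ X')) =
      ∫ X' in (S.ψ Y)..X, ∫ Y' in (S.φ X')..Y, m X' Y' := by
    refine intervalIntegral.integral_congr_ae ?_
    filter_upwards [hf] with x hx _ using hx.sub_eq _ _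
  have e2 : ∫ Y' in (S.φ X)..Y, (g X Y' - g (S.ψ Y') Y') =
      ∫ Y' in (S.φ X)..Y, ∫ X' in (S.ψ Y')..X, m X' Y' := by
    refine intervalIntegral.integral_congr_ae ?_
    filter_upwards [hg] with x hx _ using hx.sub_eq _ _
  rw [e1, e2, S.fubini hm hb]

end CharSystem

/-! ### The time function -/

lemma LocBdd₂.comp_antitone {f : ℝ → ℝ → ℝ} (hf : LocBdd₂ f) {φ : ℝ → ℝ} (hφ : Antitone φ) :
    LocBdd fun X => f X (φ X) := by
  intro r
  obtain ⟨C, hC⟩ := hf (max r (max |φ r| |φ (-r)|))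
  have h1 := le_max_left r (max |φ r| |φ (-r)|)
  have h2 := le_max_right r (max |φ r| |φ (-r)|)
  have h3 := le_max_left |φ r| |φ (-r)|
  have h4 := le_max_right |φ r| |φ (-r)|
  refine ⟨C, fun X hX => hC X ⟨by linarith [hX.1], by linarith [hX.2]⟩ _ ⟨?_, ?_⟩⟩
  · linarith [hφ hX.2, neg_abs_le (φ r)]
  · linarith [hφ hX.1, le_abs_self (φ (-r))]

lemma LocBdd₂.intervalIntegrable_left {f : ℝ → ℝ → ℝ} (hf : LocBdd₂ f)
    (hm : Measurable (Function.uncurry f)) (Y a b : ℝ) :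
    IntervalIntegrable (fun X => f X Y) volume a b :=
  (hf.flip.locBdd Y).intervalIntegrable hm.of_uncurry_right a b

lemma LocBdd₂.intervalIntegrable_right {f : ℝ → ℝ → ℝ} (hf : LocBdd₂ f)
    (hm : Measurable (Function.uncurry f)) (X a b : ℝ) : IntervalIntegrable (f X) volume a b :=
  (hf.locBdd X).intervalIntegrable hm.of_uncurry_left a b

namespace CharSystem

variable (S : CharSystem)

lemma isPrimitive_β : ∀ᵐ Y, IsPrimitive (fun X => S.β X Y) fun X => S.timeXY X Y := by
  filter_upwards [S.swap.isPrimitive_α] with Y hY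
  exact hY.congr (fun _ => rfl) fun X => (S.swap_timeXY Y X).symm

lemma intervalIntegrable_base {f : ℝ → ℝ → ℝ} (hm : Measurable (Function.uncurry f))
    (hf : LocBdd₂ f) (a b : ℝ) : IntervalIntegrable (fun X => f X (S.φ X)) volume a b :=
  (hf.comp_antitone S.antitone_φ).intervalIntegrable
    (hm.comp (measurable_id.prodMk S.measurable_φ)) a b

lemma T_eq (X Y : ℝ) : S.T X Y = ∫ X' in (S.ψ Y)..X, S.α X' Y := by
  have h := S.closed_form S.measurable_timeXY S.locBdd_timeXY S.isPrimitive_α S.isPrimitive_β X Y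
  have hβ : IntervalIntegrable (fun Y' => S.β (S.ψ Y') Y') volume (S.φ X) Y :=
    S.swap.intervalIntegrable_base S.swap.measurable_α S.swap.locBdd_α _ _
  rw [intervalIntegral.integral_sub
      (S.locBdd_α.intervalIntegrable_left S.measurable_α _ _ _)
      (S.intervalIntegrable_base S.measurable_α S.locBdd_α _ _),
    intervalIntegral.integral_sub
      (S.locBdd_β.intervalIntegrable_right S.measurable_β _ _ _)
      hβ] at h
  have hb : ∫ X' in (S.ψ Y)..X, S.α X' (S.φ X') = ∫ Y' in (S.φ X)..Y, S.β (S.ψ Y') Y' :=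
    S.base_time X Y
  rw [hb, sub_left_inj] at h
  exact h.symm

lemma swap_T (X Y : ℝ) : S.swap.T X Y = S.T Y X := (S.T_eq Y X).symm

lemma isPrimitive_T (X : ℝ) : IsPrimitive (S.T X) (S.β X) := by
  refine .of_base (f0 := 0) (a := S.φ X) S.measurable_β.of_uncurry_left (S.locBdd_β.locBdd X)
    fun Y => ?_
  simp [T]

lemma isPrimitive_T' (Y : ℝ) : IsPrimitive (fun X => S.T X Y) fun X => S.α X Y :=
  (S.swap.isPrimitive_T Y).congr (fun X => (S.swap_T Y X).symm) fun _ => rfl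

lemma T_mono_right (X : ℝ) : Monotone (S.T X) := by
  intro Y Y' h
  rw [← sub_nonneg, (S.isPrimitive_T X).sub_eq]
  refine intervalIntegral.integral_nonneg_of_ae h ?_
  filter_upwards [S.β_nonneg] with y hy using hy X

lemma T_mono_left (Y : ℝ) : Monotone fun X => S.T X Y := by
  have := S.swap.T_mono_right Y
  rwa [show S.swap.T Y = fun X => S.T X Y from funext (S.swap_T Y)] at this

lemma T_φ (X : ℝ) : S.T X (S.φ X) = 0 := by simp [T]

lemma lt_φ_of_T_neg {X Y : ℝ} (h : S.T X Y < 0) : Y < S.φ X := by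
  by_contra! h'
  linarith [S.T_mono_right X h', S.T_φ X]

/-! ### Conservation of energy -/

/-- The backward energy on the base curve is finite. -/
lemma integrable_base : Integrable fun X => S.F X (S.φ X) := by
  refine ⟨(S.measurable_F.comp (measurable_id.prodMk S.measurable_φ)).aestronglyMeasurable, ?_⟩
  rw [hasFiniteIntegral_iff_ofReal (by filter_upwards [S.F_nonneg] with X hX using hX _)]
  exact (le_self_add.trans S.base_energy).trans_lt ENNReal.ofReal_lt_top

lemma integral_base_add_le : (∫ X, S.F X (S.φ X)) + ∫ Y, S.G (S.ψ Y) Y ≤ S.E := by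
  have h := S.base_energy
  rw [← ENNReal.ofReal_le_ofReal_iff S.E_nonneg]
  have h1 := ofReal_integral_eq_lintegral_ofReal S.integrable_base
    (by filter_upwards [S.F_nonneg] with X hX using hX _)
  have h2 := ofReal_integral_eq_lintegral_ofReal S.swap.integrable_base
    (by filter_upwards [S.swap.F_nonneg] with X hX using hX _)
  simp only [swap_F, swap_φ] at h2
  rw [ENNReal.ofReal_add, h1, h2]
  · exact h
  · exact integral_nonneg_of_ae (by filter_upwards [S.F_nonneg] with X hX using hX _)
  · exact integral_nonneg_of_ae (by filter_upwards [S.G_nonneg] with X hX using hX _)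

/-- A bounded region `D` above the base curve, whose vertical sections are the intervals from `φ X`
to `a X`, up to endpoints. -/
structure IsCap (a : ℝ → ℝ) (D : Set (ℝ × ℝ)) (x₁ y₁ : ℝ) : Prop where
  measurableSet : MeasurableSet D
  le : ∀ X, S.φ X ≤ a X
  mem : ∀ X Y, S.φ X < Y → Y < a X → (X, Y) ∈ D
  mem_Icc : ∀ X Y, (X, Y) ∈ D → S.φ X ≤ Y ∧ Y ≤ a X
  bdd : ∀ X Y, (X, Y) ∈ D → X ≤ x₁ ∧ Y ≤ y₁

variable {S} {a b : ℝ → ℝ} {D : Set (ℝ × ℝ)} {x₁ y₁ : ℝ}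

lemma IsCap.integrable (hD : S.IsCap a D x₁ y₁) :
    Integrable (D.indicator (Function.uncurry S.h)) (volume.prod volume) := by
  rw [integrable_indicator_iff hD.measurableSet, ← Measure.volume_eq_prod]
  refine (S.locBdd_h.integrableOn S.measurable_h (S.ψ y₁) x₁ (S.φ x₁) y₁).mono_set ?_
  rintro ⟨X, Y⟩ h
  have h1 := hD.mem_Icc X Y h
  have h2 := hD.bdd X Y h
  exact ⟨⟨(S.antitone_ψ h2.2).trans ((S.le_iff X Y).1 h1.1), h2.1⟩,
    (S.antitone_φ h2.1).trans h1.1, h2.2⟩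

lemma IsCap.section_eq (hD : S.IsCap a D x₁ y₁) :
    ∀ᵐ X, S.F X (a X) = S.F X (S.φ X) + ∫ Y, D.indicator (Function.uncurry S.h) (X, Y) := by
  filter_upwards [S.isPrimitive_F] with X hX
  rw [← sub_eq_iff_eq_add', hX.sub_eq, intervalIntegral.integral_of_le (hD.le X),
    ← integral_indicator measurableSet_Ioc]
  refine integral_congr_ae ?_
  have h1 : ∀ᵐ Y : ℝ, Y ≠ a X := Measure.ae_ne _ _
  have h2 : ∀ᵐ Y : ℝ, Y ≠ S.φ X := Measure.ae_ne _ _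
  filter_upwards [h1, h2] with Y h1 h2
  by_cases h : (X, Y) ∈ D
  · have := hD.mem_Icc X Y h
    rw [indicator_of_mem h, indicator_of_mem (show Y ∈ Ioc (S.φ X) (a X) from
      ⟨lt_of_le_of_ne this.1 (Ne.symm h2), this.2⟩)]
    rfl
  · rw [indicator_of_notMem h, indicator_of_notMem]
    exact fun h' => h (hD.mem X Y h'.1 (lt_of_le_of_ne h'.2 h1))

lemma IsCap.integrable_top (hD : S.IsCap a D x₁ y₁) : Integrable fun X => S.F X (a X) :=
  (S.integrable_base.add hD.integrable.integral_prod_left).congr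
    (by filter_upwards [hD.section_eq] with X hX using hX.symm)

lemma IsCap.integral_top (hD : S.IsCap a D x₁ y₁) :
    ∫ X, S.F X (a X) = (∫ X, S.F X (S.φ X)) +
      ∫ X, ∫ Y, D.indicator (Function.uncurry S.h) (X, Y) := by
  rw [← integral_add S.integrable_base hD.integrable.integral_prod_left]
  exact integral_congr_ae hD.section_eq

/-- The energies on the two parts of the boundary of a region above the base curve add up to the
energy of a part of the base curve: Green's theorem for the closed form `F dX - G dY`. -/
lemma IsCap.lintegral_le (hD : S.IsCap a D x₁ y₁)
    (hD' : S.swap.IsCap b (Prod.swap ⁻¹' D) y₁ x₁) :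
    ∫⁻ X, ENNReal.ofReal (S.F X (a X)) ≤ ENNReal.ofReal S.E := by
  have h1 := hD.integral_top
  have h2 := hD'.integral_top
  have h3 : ∫ Y, ∫ X, (Prod.swap ⁻¹' D).indicator (Function.uncurry S.swap.h) (Y, X) =
      -∫ X, ∫ Y, D.indicator (Function.uncurry S.h) (X, Y) := by
    rw [integral_integral_swap (f := fun X Y => D.indicator (Function.uncurry S.h) (X, Y))
      hD.integrable, ← integral_neg]
    congr 1
    ext Y
    rw [← integral_neg]
    congr 1
    ext X
    by_cases h : (X, Y) ∈ D
    · rw [indicator_of_mem h, indicator_of_mem (by exact h)]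
      exact S.swap_h Y X
    · rw [indicator_of_notMem h, indicator_of_notMem (by exact h), neg_zero]
  rw [h3] at h2
  have h4 : 0 ≤ ∫ Y, S.swap.F Y (b Y) :=
    integral_nonneg_of_ae (by filter_upwards [S.swap.F_nonneg] with X hX using hX _)
  have h5 := S.integral_base_add_le
  rw [← ofReal_integral_eq_lintegral_ofReal hD.integrable_top
    (by filter_upwards [S.F_nonneg] with X hX using hX _)]
  refine ENNReal.ofReal_le_ofReal ?_
  simp only [swap_F, swap_φ] at h2 h4
  linarith

variable (S)

/-- The energy that crosses a horizontal segment starting at the base curve. -/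
lemma lintegral_horizontal_segment_le (X Y : ℝ) :
    ∫⁻ X' in Ioc (S.ψ Y) X, ENNReal.ofReal (S.F X' Y) ≤ ENNReal.ofReal S.E := by
  classical
  let D : Set (ℝ × ℝ) := {P | S.φ P.1 < P.2 ∧ P.1 ≤ X ∧ P.2 ≤ Y}
  have hDm : MeasurableSet D :=
    (measurableSet_lt (S.measurable_φ.comp measurable_fst) measurable_snd).inter
      ((measurableSet_le measurable_fst measurable_const).inter
        (measurableSet_le measurable_snd measurable_const))
  have hD : S.IsCap (fun X' => if X' ≤ X then max (S.φ X') Y else S.φ X') D X Y := by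
    refine ⟨hDm, fun x => ?_, fun x y h1 h2 => ?_, fun x y h => ?_, fun x y h => h.2⟩
    · split_ifs <;> simp
    · split_ifs at h2 with h3
      · exact ⟨h1, h3, ((lt_max_iff.1 h2).resolve_left h1.not_gt).le⟩
      · exact absurd h2 h1.not_gt
    · obtain ⟨h1, h2, h3⟩ := h
      simp only at h1 h2 h3
      rw [if_pos h2]
      exact ⟨h1.le, h3.trans (le_max_right _ _)⟩
  have hD' : S.swap.IsCap (fun Y' => if Y' ≤ Y then max (S.ψ Y') X else S.ψ Y')
      (Prod.swap ⁻¹' D) Y X := by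
    refine ⟨measurable_swap hDm, fun x => ?_, fun y x h1 h2 => ?_, fun y x h => ?_,
      fun x y h => ⟨h.2.2, h.2.1⟩⟩
    · simp only [swap_φ]; split_ifs <;> simp
    · rw [swap_φ] at h1
      split_ifs at h2 with h3
      · exact ⟨(S.lt_iff _ _).2 h1, ((lt_max_iff.1 h2).resolve_left h1.not_gt).le, h3⟩
      · exact absurd h2 h1.not_gt
    · obtain ⟨h1, h2, h3⟩ := h
      simp only [Prod.swap, swap_φ] at h1 h2 h3 ⊢
      rw [if_pos h3]
      exact ⟨((S.lt_iff _ _).1 h1).le, h2.trans (le_max_right _ _)⟩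
  refine le_trans ?_ (hD.lintegral_le hD')
  refine le_trans (le_of_eq ?_) (setLIntegral_le_lintegral (Ioc (S.ψ Y) X) _)
  refine setLIntegral_congr_fun measurableSet_Ioc fun X' hX' => ?_
  have : S.φ X' ≤ Y := (S.le_iff _ _).2 hX'.1.le
  simp [hX'.2, this]

lemma lintegral_horizontal_ray_le (Y : ℝ) :
    ∫⁻ X in Ioi (S.ψ Y), ENNReal.ofReal (S.F X Y) ≤ ENNReal.ofReal S.E := by
  have : Ioi (S.ψ Y) = ⋃ n : ℕ, Ioc (S.ψ Y) n := by
    ext x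
    simp only [mem_Ioi, mem_iUnion, mem_Ioc, exists_and_left, iff_self_and]
    exact fun _ => exists_nat_ge x
  rw [this, setLIntegral_iUnion_of_directed]
  · exact iSup_le fun n => S.lintegral_horizontal_segment_le n Y
  · exact (monotone_nat_of_le_succ fun n => Ioc_subset_Ioc_right (by simp)).directed_le

/-- The energy that crosses a horizontal line. -/
lemma lintegral_horizontal_le (Y : ℝ) :
    ∫⁻ X, ENNReal.ofReal (S.F X Y) ≤ 2 * ENNReal.ofReal S.E := by
  have h1 := S.lintegral_horizontal_ray_le Y
  have h2 := S.reflect.lintegral_horizontal_ray_le (-Y)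
  simp only [reflect_ψ, neg_neg, reflect_F, reflect_E] at h2
  have h3 : ∫⁻ X in Ioi (-S.ψ Y), ENNReal.ofReal (S.F (-X) Y) =
      ∫⁻ X in Iio (S.ψ Y), ENNReal.ofReal (S.F X Y) := by
    rw [← lintegral_indicator measurableSet_Ioi, ← lintegral_indicator measurableSet_Iio,
      ← lintegral_neg_eq_self]
    congr 1
    ext X
    simp [indicator, neg_lt]
  rw [h3, setLIntegral_congr Iio_ae_eq_Iic] at h2
  rw [← lintegral_add_compl _ (measurableSet_Ioi (a := S.ψ Y)), compl_Ioi, two_mul]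
  exact add_le_add h1 h2

lemma lintegral_vertical_le (X : ℝ) :
    ∫⁻ Y, ENNReal.ofReal (S.G X Y) ≤ 2 * ENNReal.ofReal S.E :=
  S.swap.lintegral_horizontal_le X

/-! ### The time is unbounded along characteristics -/

lemma integral_F_horizontal_le {X Y : ℝ} (h : S.ψ Y ≤ X) :
    ∫ X' in (S.ψ Y)..X, S.F X' Y ≤ S.E := by
  rw [intervalIntegral.integral_of_le h, ← ENNReal.ofReal_le_ofReal_iff S.E_nonneg,
    ofReal_integral_eq_lintegral_ofReal]
  · exact S.lintegral_horizontal_segment_le X Y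
  · exact (S.locBdd_F.intervalIntegrable_left S.measurable_F Y _ _).1
  · exact ae_restrict_of_ae (by filter_upwards [S.F_nonneg] with X hX using hX _)

lemma p_le (X Y : ℝ) (hp : 0 ≤ S.p X Y) :
    S.p X Y ≤ 2 * S.κ * S.α X Y + 4 * S.F X Y := by
  have h1 := S.c_pos (S.u X Y)
  have h2 := S.c_le (S.u X Y)
  have h3 : 0 ≤ 1 + Real.cos (S.w X Y) := by linarith [Real.neg_one_le_cos (S.w X Y)]
  have h4 : S.c (S.u X Y) * S.α X Y = (1 + Real.cos (S.w X Y)) * S.p X Y / 4 := by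
    simp only [α]; field_simp
  have h5 : 0 ≤ S.α X Y := by simp only [α]; positivity
  have h6 : S.c (S.u X Y) * S.α X Y ≤ S.κ * S.α X Y := mul_le_mul_of_nonneg_right h2 h5
  simp only [F]
  linarith

lemma integral_p_le {X Y : ℝ} (h : S.ψ Y ≤ X) :
    ∫ X' in (S.ψ Y)..X, S.p X' Y ≤ 2 * S.κ * S.T X Y + 4 * S.E := by
  have ia := S.locBdd_α.intervalIntegrable_left S.measurable_α Y (S.ψ Y) X
  have iF := S.locBdd_F.intervalIntegrable_left S.measurable_F Y (S.ψ Y) X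
  have h1 : ∫ X' in (S.ψ Y)..X, S.p X' Y ≤
      ∫ X' in (S.ψ Y)..X, (2 * S.κ * S.α X' Y + 4 * S.F X' Y) := by
    refine intervalIntegral.integral_mono_ae h
      (S.locBdd_p.intervalIntegrable_left S.measurable_p Y _ _)
      ((ia.const_mul _).add (iF.const_mul _)) ?_
    filter_upwards [S.p_pos] with x hx using S.p_le x Y (hx Y).le
  rw [intervalIntegral.integral_add (ia.const_mul _) (iF.const_mul _),
    intervalIntegral.integral_const_mul, intervalIntegral.integral_const_mul, ← S.T_eq] at h1
  linarith [S.integral_F_horizontal_le h]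

lemma exp_neg_le_q : ∀ᵐ Y, ∀ X, S.ψ Y ≤ X →
    Real.exp (-(2 * S.k₀ * (2 * S.κ * S.T X Y + 4 * S.E))) ≤ S.q X Y := by
  filter_upwards [S.swap.p_eq_exp] with Y hY X hX
  have h0 := hY X
  simp only [swap_p, swap_φ, swap_k, swap_z, swap_w, swap_q] at h0
  rw [h0, Real.exp_le_exp, neg_le]
  have h1 : |∫ X' in (S.ψ Y)..X, S.k X' Y * (Real.sin (S.w X' Y) - Real.sin (S.z X' Y)) *
      S.p X' Y| ≤ ∫ X' in (S.ψ Y)..X, 2 * S.k₀ * S.p X' Y := by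
    rw [← Real.norm_eq_abs]
    refine intervalIntegral.norm_integral_le_of_norm_le (g := fun X' => 2 * S.k₀ * S.p X' Y)
      hX ?_ ((S.locBdd_p.intervalIntegrable_left S.measurable_p Y _ _).const_mul _)
    filter_upwards [S.p_pos] with x hx _
    have hs : |Real.sin (S.w x Y) - Real.sin (S.z x Y)| ≤ 2 := by
      rw [abs_le]
      constructor <;> linarith [Real.neg_one_le_sin (S.z x Y), Real.sin_le_one (S.z x Y),
        Real.neg_one_le_sin (S.w x Y), Real.sin_le_one (S.w x Y)]
    have hk : |S.k x Y| ≤ S.k₀ := S.k_le _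
    rw [Real.norm_eq_abs, abs_mul, abs_mul, abs_of_pos (hx Y)]
    refine mul_le_mul_of_nonneg_right ?_ (hx Y).le
    rw [mul_comm 2]
    exact mul_le_mul hk hs (abs_nonneg _) S.k₀_nonneg
  rw [intervalIntegral.integral_const_mul] at h1
  have h2 := S.integral_p_le hX
  have h3 := mul_le_mul_of_nonneg_left h2 (mul_nonneg zero_le_two S.k₀_nonneg)
  linarith [neg_le_abs (∫ X' in (S.ψ Y)..X,
      S.k X' Y * (Real.sin (S.w X' Y) - Real.sin (S.z X' Y)) * S.p X' Y)]

/-- Bounded time means bounded length along a vertical characteristic above the base curve: the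
integral of `q` is controlled by time and energy, and so is a positive lower bound of `q`. -/
lemma sub_mul_exp_le {X Y : ℝ} (h : S.φ X ≤ Y) :
    (Y - S.φ X) * Real.exp (-(2 * S.k₀ * (2 * S.κ * S.T X Y + 4 * S.E))) ≤
      2 * S.κ * S.T X Y + 4 * S.E := by
  have h1 := S.swap.integral_p_le h
  simp only [swap_ψ, swap_p, swap_κ, swap_T, swap_E] at h1
  refine le_trans ?_ h1
  have h2 : ∫ _ in (S.φ X)..Y, Real.exp (-(2 * S.k₀ * (2 * S.κ * S.T X Y + 4 * S.E))) =
      (Y - S.φ X) * Real.exp (-(2 * S.k₀ * (2 * S.κ * S.T X Y + 4 * S.E))) := by simp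
  rw [← h2]
  refine intervalIntegral.integral_mono_ae_restrict h (by simp)
    (S.locBdd_q.intervalIntegrable_right S.measurable_q X _ _) ?_
  filter_upwards [ae_restrict_of_ae S.exp_neg_le_q, ae_restrict_mem measurableSet_Icc] with y hy h'
  refine le_trans (Real.exp_le_exp.2 ?_) (hy X ((S.le_iff _ _).1 h'.1))
  have h3 := S.T_mono_right X h'.2
  have := S.κ_pos
  have := S.k₀_nonneg
  gcongr

lemma exists_lt_T (X τ : ℝ) : ∃ Y, τ < S.T X Y := by
  by_contra! hτ
  have hκ := S.κ_pos
  have hk := S.k₀_nonneg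
  have hE := S.E_nonneg
  set M := 2 * S.κ * |τ| + 4 * S.E with hM
  have hM0 : 0 ≤ M := by positivity
  have hY : S.φ X ≤ S.φ X + (M * Real.exp (2 * S.k₀ * M) + 1) := by
    have : 0 ≤ M * Real.exp (2 * S.k₀ * M) := by positivity
    linarith
  have h := S.sub_mul_exp_le hY
  have h2 : 2 * S.κ * S.T X (S.φ X + (M * Real.exp (2 * S.k₀ * M) + 1)) + 4 * S.E ≤ M := by
    have := (hτ (S.φ X + (M * Real.exp (2 * S.k₀ * M) + 1))).trans (le_abs_self τ)
    rw [hM]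
    gcongr
  have h3 : Real.exp (-(2 * S.k₀ * M)) ≤ Real.exp (-(2 * S.k₀ * (2 * S.κ * S.T X
      (S.φ X + (M * Real.exp (2 * S.k₀ * M) + 1)) + 4 * S.E))) := by
    rw [Real.exp_le_exp]
    gcongr
  have h4 : (M * Real.exp (2 * S.k₀ * M) + 1) * Real.exp (-(2 * S.k₀ * M)) ≤ M := by
    refine le_trans (mul_le_mul_of_nonneg_left h3 (by positivity)) ?_
    rw [add_sub_cancel_left] at h
    exact h.trans h2
  rw [add_mul, mul_assoc, ← Real.exp_add, add_neg_cancel, Real.exp_zero] at h4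
  linarith [Real.exp_pos (-(2 * S.k₀ * M))]

lemma exists_T_lt (X τ : ℝ) : ∃ Y, S.T X Y < τ := by
  obtain ⟨Y, hY⟩ := S.reflect.exists_lt_T (-X) (-τ)
  rw [reflect_T, neg_neg, neg_lt_neg_iff] at hY
  exact ⟨_, hY⟩

/-! ### The level curves of time -/

/-- The highest point of `{t ≤ τ}` on the vertical line of abscissa `X`. -/
noncomputable def top (τ X : ℝ) : ℝ := sSup {Y | S.T X Y ≤ τ}

/-- The rightmost point of `{t ≤ τ}` on the horizontal line of ordinate `Y`. -/
noncomputable def right (τ Y : ℝ) : ℝ := sSup {X | S.T X Y ≤ τ}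

lemma swap_top (τ Y : ℝ) : S.swap.top τ Y = S.right τ Y := by simp only [top, right, swap_T]

lemma le_top_iff (τ X Y : ℝ) : Y ≤ S.top τ X ↔ S.T X Y ≤ τ := by
  have hbdd : BddAbove {Y | S.T X Y ≤ τ} := by
    obtain ⟨Y₁, h₁⟩ := S.exists_lt_T X τ
    refine ⟨Y₁, fun Y hY => ?_⟩
    by_contra! h
    exact absurd (S.T_mono_right X h.le) (not_le.2 (lt_of_le_of_lt hY h₁))
  have hne : {Y | S.T X Y ≤ τ}.Nonempty := by
    obtain ⟨Y₁, h₁⟩ := S.exists_T_lt X τ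
    exact ⟨Y₁, h₁.le⟩
  have hcl : IsClosed {Y | S.T X Y ≤ τ} :=
    isClosed_le (S.isPrimitive_T X).continuous continuous_const
  exact ⟨fun h => (S.T_mono_right X h).trans (hcl.csSup_mem hne hbdd), fun h => le_csSup hbdd h⟩

lemma top_lt_iff (τ X Y : ℝ) : S.top τ X < Y ↔ τ < S.T X Y := by
  rw [← not_le, S.le_top_iff, not_le]

lemma le_right_iff (τ X Y : ℝ) : X ≤ S.right τ Y ↔ S.T X Y ≤ τ := by
  rw [← swap_top, S.swap.le_top_iff, swap_T]

lemma right_lt_iff (τ X Y : ℝ) : S.right τ Y < X ↔ τ < S.T X Y := by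
  rw [← not_le, S.le_right_iff, not_le]

lemma T_top (τ X : ℝ) : S.T X (S.top τ X) = τ := by
  refine le_antisymm ((S.le_top_iff _ _ _).1 le_rfl) ?_
  have h : Filter.Tendsto (S.T X) (nhdsWithin (S.top τ X) (Ioi (S.top τ X)))
      (nhds (S.T X (S.top τ X))) := (S.isPrimitive_T X).continuous.continuousWithinAt
  refine ge_of_tendsto h ?_
  filter_upwards [self_mem_nhdsWithin] with Y hY using ((S.top_lt_iff _ _ _).1 hY).le

lemma T_right (τ Y : ℝ) : S.T (S.right τ Y) Y = τ := by
  rw [← swap_top, ← S.swap_T, S.swap.T_top]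

lemma antitone_top (τ : ℝ) : Antitone (S.top τ) := fun X X' h => by
  rw [le_top_iff]
  exact (S.T_mono_left _ h).trans (S.T_top τ X').le

lemma antitone_right (τ : ℝ) : Antitone (S.right τ) := by
  have := S.swap.antitone_top τ
  rwa [show S.swap.top τ = S.right τ from funext (S.swap_top τ)] at this

lemma measurable_top (τ : ℝ) : Measurable (S.top τ) := (S.antitone_top τ).measurable
lemma measurable_right (τ : ℝ) : Measurable (S.right τ) := (S.antitone_right τ).measurable

lemma top_mono {τ₁ τ₂ : ℝ} (h : τ₁ ≤ τ₂) (X : ℝ) : S.top τ₁ X ≤ S.top τ₂ X := by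
  rw [le_top_iff, T_top]
  exact h

/-- The energy on a curve above the base curve, given as the boundary of a region `A`. -/
lemma lintegral_curve_le {a b : ℝ → ℝ} {A : Set (ℝ × ℝ)} (hA : MeasurableSet A)
    (ha : Measurable a) (hφ : ∀ X, S.φ X ≤ a X)
    (h₁ : ∀ X Y, Y < a X → (X, Y) ∈ A) (h₂ : ∀ X Y, (X, Y) ∈ A → Y ≤ a X)
    (h₃ : ∀ X Y, X < b Y → (X, Y) ∈ A) (h₄ : ∀ X Y, (X, Y) ∈ A → X ≤ b Y) :
    ∫⁻ X, ENNReal.ofReal (S.F X (a X)) ≤ ENNReal.ofReal S.E := by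
  classical
  -- Green's theorem needs a bounded region: take the part in the quadrant `X ≤ n`, `Y ≤ n`.
  have key : ∀ n : ℕ, ∫⁻ X in {X : ℝ | X ≤ n ∧ a X ≤ n}, ENNReal.ofReal (S.F X (a X)) ≤
      ENNReal.ofReal S.E := by
    intro n
    let D : Set (ℝ × ℝ) := {P | S.φ P.1 < P.2 ∧ P ∈ A ∧ P.1 ≤ n ∧ P.2 ≤ n}
    have hDm : MeasurableSet D :=
      (measurableSet_lt (S.measurable_φ.comp measurable_fst) measurable_snd).inter
        (hA.inter ((measurableSet_le measurable_fst measurable_const).inter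
          (measurableSet_le measurable_snd measurable_const)))
    have hD : S.IsCap (fun X => if X ≤ n then max (S.φ X) (min (a X) n) else S.φ X) D n n := by
      refine ⟨hDm, fun x => ?_, fun x y h1 h2 => ?_, fun x y h => ?_, fun x y h => h.2.2⟩
      · split_ifs <;> simp
      · split_ifs at h2 with h3
        · have h4 := lt_min_iff.1 ((lt_max_iff.1 h2).resolve_left h1.not_gt)
          exact ⟨h1, h₁ _ _ h4.1, h3, h4.2.le⟩
        · exact absurd h2 h1.not_gt
      · obtain ⟨h1, h2, h3, h4⟩ := h
        simp only at h1 h3 h4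
        rw [if_pos h3]
        exact ⟨h1.le, (le_min (h₂ _ _ h2) h4).trans (le_max_right _ _)⟩
    have hD' : S.swap.IsCap (fun Y => if Y ≤ n then max (S.ψ Y) (min (b Y) n) else S.ψ Y)
        (Prod.swap ⁻¹' D) n n := by
      refine ⟨measurable_swap hDm, fun x => ?_, fun y x h1 h2 => ?_, fun y x h => ?_,
        fun x y h => ⟨h.2.2.2, h.2.2.1⟩⟩
      · simp only [swap_φ]; split_ifs <;> simp
      · rw [swap_φ] at h1
        split_ifs at h2 with h3
        · have h4 := lt_min_iff.1 ((lt_max_iff.1 h2).resolve_left h1.not_gt)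
          exact ⟨(S.lt_iff _ _).2 h1, h₃ _ _ h4.1, h4.2.le, h3⟩
        · exact absurd h2 h1.not_gt
      · obtain ⟨h1, h2, h3, h4⟩ := h
        simp only [Prod.swap, swap_φ] at h1 h2 h3 h4 ⊢
        rw [if_pos h4]
        exact ⟨((S.lt_iff _ _).1 h1).le, (le_min (h₄ _ _ h2) h3).trans (le_max_right _ _)⟩
    refine le_trans ?_ (hD.lintegral_le hD')
    refine le_trans (le_of_eq ?_) (setLIntegral_le_lintegral {X : ℝ | X ≤ n ∧ a X ≤ n} _)
    refine setLIntegral_congr_fun ((measurableSet_le measurable_id measurable_const).inter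
      (measurableSet_le ha measurable_const)) fun X hX => ?_
    have h1 : X ≤ n := hX.1
    have h2 : a X ≤ n := hX.2
    simp only [if_pos h1, min_eq_left h2, max_eq_right (hφ X)]
  have hU : (⋃ n : ℕ, {X : ℝ | X ≤ n ∧ a X ≤ n}) = univ := by
    refine eq_univ_of_forall fun X => mem_iUnion.2 ?_
    obtain ⟨n, hn⟩ := exists_nat_ge (max X (a X))
    exact ⟨n, (le_max_left _ _).trans hn, (le_max_right _ _).trans hn⟩
  rw [← setLIntegral_univ, ← hU, setLIntegral_iUnion_of_directed]
  · exact iSup_le key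
  · refine (monotone_nat_of_le_succ fun n X hX => ?_).directed_le
    have : (n : ℝ) ≤ (n + 1 : ℕ) := by simp
    exact ⟨hX.1.trans this, hX.2.trans this⟩

/-- The backward energy at time `τ` is bounded by the total energy. -/
lemma lintegral_top_le (τ : ℝ) :
    ∫⁻ X, ENNReal.ofReal (S.F X (S.top τ X)) ≤ ENNReal.ofReal S.E := by
  have hm : MeasurableSet {P : ℝ × ℝ | P.2 ≤ S.top τ P.1} :=
    measurableSet_le measurable_snd ((S.measurable_top τ).comp measurable_fst)
  rcases le_or_gt 0 τ with hτ | hτ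
  · refine S.lintegral_curve_le (b := S.right τ) hm (S.measurable_top τ) (fun X => ?_)
      (fun X Y h => h.le) (fun X Y h => h) (fun X Y h => ?_) fun X Y h => ?_
    · rw [le_top_iff, T_φ]
      exact hτ
    · exact (S.le_top_iff _ _ _).2 ((S.le_right_iff _ _ _).1 h.le)
    · exact (S.le_right_iff _ _ _).2 ((S.le_top_iff _ _ _).1 h)
  · have hm' : MeasurableSet {P : ℝ × ℝ | P.2 < -S.top τ (-P.1)} :=
      measurableSet_lt measurable_snd (((S.measurable_top τ).comp measurable_fst.neg).neg)
    have h := S.reflect.lintegral_curve_le (a := fun X => -S.top τ (-X))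
      (b := fun Y => -S.right τ (-Y)) hm' ((S.measurable_top τ).comp measurable_neg).neg
      (fun X => ?_) (fun X Y h => h) (fun X Y h => le_of_lt h) (fun X Y h => ?_)
      fun X Y h => ?_
    · rw [← lintegral_neg_eq_self]
      simpa only [reflect_F, neg_neg, reflect_E] using h
    · simp only [reflect_φ, neg_le_neg_iff]
      exact (S.lt_φ_of_T_neg ((S.T_top τ (-X)).trans_lt hτ)).le
    · rw [lt_neg, right_lt_iff] at h
      rw [mem_ofPred_eq, lt_neg, top_lt_iff]
      exact h
    · rw [mem_ofPred_eq, lt_neg, top_lt_iff] at h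
      rw [le_neg]
      exact ((S.right_lt_iff _ _ _).2 h).le

lemma lintegral_right_le (τ : ℝ) :
    ∫⁻ Y, ENNReal.ofReal (S.G (S.right τ Y) Y) ≤ ENNReal.ofReal S.E := by
  have := S.swap.lintegral_top_le τ
  simpa only [swap_top, swap_F, swap_E] using this

end CharSystem

namespace CharSystem

variable (S : CharSystem)

/-! ### The exchange of energy in a strip of time -/

/-- The interaction potential at time `τ`, as an integral over the points of the characteristic
plane above the curve of time `τ`. -/
noncomputable def potential (τ : ℝ) : ℝ≥0∞ :=
  ∫⁻ P in {P : ℝ × ℝ | τ < S.T P.1 P.2}, ENNReal.ofReal (S.F P.1 (S.top τ P.1)) *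
    ENNReal.ofReal (S.G (S.right τ P.2) P.2) ∂(volume.prod volume)

/-- A measurable part `D` of the strip `s < t(X, Y) ≤ t` which contains, with a point, all points
of the strip to the left of it and below it. -/
structure IsInitial (s t : ℝ) (D : Set (ℝ × ℝ)) : Prop where
  measurableSet : MeasurableSet D
  mem : ∀ X Y, (X, Y) ∈ D → s < S.T X Y ∧ S.T X Y ≤ t
  down : ∀ X Y X' Y', (X, Y) ∈ D → X' ≤ X → Y' ≤ Y → s < S.T X' Y' → (X', Y') ∈ D

/-- The exchange of energy in `D` along the vertical line of abscissa `X`. -/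
noncomputable def exchange (D : Set (ℝ × ℝ)) (X : ℝ) : ℝ≥0∞ :=
  ∫⁻ Y, D.indicator (fun P => ENNReal.ofReal |S.h P.1 P.2|) (X, Y)

/-- The total exchange of energy in `D`. -/
noncomputable def totalExchange (D : Set (ℝ × ℝ)) : ℝ≥0∞ :=
  ∫⁻ P in D, ENNReal.ofReal |S.h P.1 P.2| ∂(volume.prod volume)

lemma ae_fst {P : ℝ → Prop} (h : ∀ᵐ x : ℝ, P x) :
    ∀ᵐ z : ℝ × ℝ ∂(volume.prod volume), P z.1 :=
  Measure.quasiMeasurePreserving_fst.ae h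

lemma ae_snd {P : ℝ → Prop} (h : ∀ᵐ x : ℝ, P x) :
    ∀ᵐ z : ℝ × ℝ ∂(volume.prod volume), P z.2 :=
  Measure.quasiMeasurePreserving_snd.ae h

lemma measurable_ofReal_F : Measurable fun P : ℝ × ℝ => ENNReal.ofReal (S.F P.1 P.2) :=
  S.measurable_F.ennreal_ofReal

lemma measurable_ofReal_G : Measurable fun P : ℝ × ℝ => ENNReal.ofReal (S.G P.1 P.2) :=
  S.measurable_G.ennreal_ofReal

lemma measurable_ofReal_h : Measurable fun P : ℝ × ℝ => ENNReal.ofReal |S.h P.1 P.2| :=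
  S.measurable_h.abs.ennreal_ofReal

lemma measurable_F_top (τ : ℝ) : Measurable fun X => ENNReal.ofReal (S.F X (S.top τ X)) :=
  (S.measurable_F.comp (measurable_id.prodMk (S.measurable_top τ))).ennreal_ofReal

lemma measurable_G_right (τ : ℝ) : Measurable fun Y => ENNReal.ofReal (S.G (S.right τ Y) Y) :=
  (S.measurable_G.comp ((S.measurable_right τ).prodMk measurable_id)).ennreal_ofReal

lemma measurableSet_lt_T (τ : ℝ) : MeasurableSet {P : ℝ × ℝ | τ < S.T P.1 P.2} := by
  simp only [← top_lt_iff]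
  exact measurableSet_lt ((S.measurable_top τ).comp measurable_fst) measurable_snd

lemma measurableSet_strip (s t : ℝ) :
    MeasurableSet {P : ℝ × ℝ | s < S.T P.1 P.2 ∧ S.T P.1 P.2 ≤ t} := by
  have : {P : ℝ × ℝ | s < S.T P.1 P.2 ∧ S.T P.1 P.2 ≤ t} =
      {P : ℝ × ℝ | s < S.T P.1 P.2} \ {P : ℝ × ℝ | t < S.T P.1 P.2} := by
    ext P
    simp
  rw [this]
  exact (S.measurableSet_lt_T s).diff (S.measurableSet_lt_T t)

variable {S} {s t : ℝ} {D : Set (ℝ × ℝ)}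

lemma IsInitial.swap (hD : S.IsInitial s t D) : S.swap.IsInitial s t (Prod.swap ⁻¹' D) where
  measurableSet := measurable_swap hD.measurableSet
  mem X Y h := by simpa only [swap_T] using hD.mem Y X h
  down X Y X' Y' h hX hY hs := hD.down Y X Y' X' h hY hX (by simpa only [swap_T] using hs)

lemma setLIntegral_swap (hD : MeasurableSet D) (f : ℝ × ℝ → ℝ≥0∞) :
    ∫⁻ P in Prod.swap ⁻¹' D, f P.swap ∂(volume.prod volume) =
      ∫⁻ P in D, f P ∂((volume : Measure ℝ).prod (volume : Measure ℝ)) := by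
  rw [← lintegral_indicator hD, ← lintegral_indicator (measurable_swap hD), ← lintegral_prod_swap]
  rfl

lemma swap_totalExchange (hD : MeasurableSet D) :
    S.swap.totalExchange (Prod.swap ⁻¹' D) = S.totalExchange D := by
  simp only [totalExchange, swap_h, abs_neg]
  exact setLIntegral_swap hD fun P => ENNReal.ofReal |S.h P.1 P.2|

lemma measurable_indicator_h (hD : MeasurableSet D) :
    Measurable (D.indicator fun P => ENNReal.ofReal |S.h P.1 P.2|) :=
  S.measurable_ofReal_h.indicator hD

lemma measurable_exchange (hD : MeasurableSet D) : Measurable (S.exchange D) :=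
  (measurable_indicator_h hD).lintegral_prod_right'

lemma lintegral_exchange (hD : MeasurableSet D) :
    ∫⁻ X, S.exchange D X = S.totalExchange D := by
  rw [totalExchange, ← lintegral_indicator hD,
    lintegral_prod _ (measurable_indicator_h hD).aemeasurable]
  rfl

lemma lintegral_swap_exchange (hD : MeasurableSet D) :
    ∫⁻ Y, S.swap.exchange (Prod.swap ⁻¹' D) Y = S.totalExchange D := by
  rw [lintegral_exchange (measurable_swap hD), swap_totalExchange hD]

/-- In the strip, the energy density exceeds its value at the lower end of the vertical section by
at most the exchange along that section. -/
lemma IsInitial.F_le (hD : S.IsInitial s t D) : ∀ᵐ X, ∀ Y, (X, Y) ∈ D →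
    ENNReal.ofReal (S.F X Y) ≤ ENNReal.ofReal (S.F X (S.top s X)) + S.exchange D X := by
  filter_upwards [S.isPrimitive_F] with X hX Y hY
  have hle : S.top s X ≤ Y := ((S.top_lt_iff _ _ _).2 (hD.mem X Y hY).1).le
  have h1 : S.F X Y ≤ S.F X (S.top s X) + ∫ Y' in (S.top s X)..Y, |S.h X Y'| := by
    have := hX.sub_eq (S.top s X) Y
    have h2 : ∫ Y' in (S.top s X)..Y, S.h X Y' ≤ ∫ Y' in (S.top s X)..Y, |S.h X Y'| :=
      intervalIntegral.integral_mono_on hle (hX.intervalIntegrable _ _)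
        (hX.intervalIntegrable _ _).abs fun y _ => le_abs_self _
    linarith
  refine (ENNReal.ofReal_le_ofReal h1).trans (ENNReal.ofReal_add_le.trans ?_)
  gcongr
  rw [intervalIntegral.integral_of_le hle, ofReal_integral_eq_lintegral_ofReal
    (hX.intervalIntegrable _ _).abs.1 (.of_forall fun _ => abs_nonneg _),
    ← lintegral_indicator measurableSet_Ioc]
  refine lintegral_mono fun Y' => ?_
  refine indicator_apply_le' (fun hY' => ?_) fun _ => zero_le
  rw [indicator_of_mem]
  exact hD.down X Y X Y' hY le_rfl hY'.2 ((S.top_lt_iff _ _ _).1 hY'.1)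

lemma IsInitial.G_le (hD : S.IsInitial s t D) : ∀ᵐ Y, ∀ X, (X, Y) ∈ D →
    ENNReal.ofReal (S.G X Y) ≤
      ENNReal.ofReal (S.G (S.right s Y) Y) + S.swap.exchange (Prod.swap ⁻¹' D) Y := by
  filter_upwards [hD.swap.F_le] with Y hY X hX
  simpa only [swap_F, swap_top] using hY X hX

/-- The interaction of the densities in `D` is controlled by the interaction of their values at the
lower end of the strip and by the exchange. -/
lemma IsInitial.lintegral_mul_le (hD : S.IsInitial s t D) :
    ∫⁻ P in D, ENNReal.ofReal (S.F P.1 P.2) * ENNReal.ofReal (S.G P.1 P.2)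
        ∂(volume.prod volume) ≤
      ∫⁻ P in D, ENNReal.ofReal (S.F P.1 (S.top s P.1)) *
        ENNReal.ofReal (S.G (S.right s P.2) P.2) ∂(volume.prod volume) +
      3 * ENNReal.ofReal S.E * S.totalExchange D := by
  have hm := hD.measurableSet
  have ma : Measurable fun P : ℝ × ℝ => S.exchange D P.1 :=
    (measurable_exchange hm).comp measurable_fst
  have mb : Measurable (S.swap.exchange (Prod.swap ⁻¹' D)) :=
    measurable_exchange (measurable_swap hm)
  have mb' : Measurable fun P : ℝ × ℝ => S.swap.exchange (Prod.swap ⁻¹' D) P.2 :=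
    mb.comp measurable_snd
  have mF : Measurable fun P : ℝ × ℝ => ENNReal.ofReal (S.F P.1 (S.top s P.1)) :=
    (S.measurable_F_top s).comp measurable_fst
  have mG : Measurable fun P : ℝ × ℝ => ENNReal.ofReal (S.G (S.right s P.2) P.2) :=
    (S.measurable_G_right s).comp measurable_snd
  have h1 : ∫⁻ P in D, ENNReal.ofReal (S.F P.1 P.2) * ENNReal.ofReal (S.G P.1 P.2)
        ∂(volume.prod volume) ≤
      ∫⁻ P in D, (ENNReal.ofReal (S.F P.1 (S.top s P.1)) *
        ENNReal.ofReal (S.G (S.right s P.2) P.2) +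
        (ENNReal.ofReal (S.F P.1 (S.top s P.1)) * S.swap.exchange (Prod.swap ⁻¹' D) P.2 +
          S.exchange D P.1 * ENNReal.ofReal (S.G P.1 P.2))) ∂(volume.prod volume) := by
    refine lintegral_mono_ae ?_
    filter_upwards [ae_restrict_of_ae (ae_fst hD.F_le), ae_restrict_of_ae (ae_snd hD.G_le),
      ae_restrict_mem hm] with P hF hG hP
    calc _ ≤ (ENNReal.ofReal (S.F P.1 (S.top s P.1)) + S.exchange D P.1) *
          ENNReal.ofReal (S.G P.1 P.2) := by gcongr; exact hF _ hP
      _ = ENNReal.ofReal (S.F P.1 (S.top s P.1)) * ENNReal.ofReal (S.G P.1 P.2) +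
          S.exchange D P.1 * ENNReal.ofReal (S.G P.1 P.2) := add_mul _ _ _
      _ ≤ ENNReal.ofReal (S.F P.1 (S.top s P.1)) * (ENNReal.ofReal (S.G (S.right s P.2) P.2) +
            S.swap.exchange (Prod.swap ⁻¹' D) P.2) +
          S.exchange D P.1 * ENNReal.ofReal (S.G P.1 P.2) := by gcongr; exact hG _ hP
      _ = _ := by rw [mul_add, add_assoc]
  have h2 : ∫⁻ P in D, ENNReal.ofReal (S.F P.1 (S.top s P.1)) *
      S.swap.exchange (Prod.swap ⁻¹' D) P.2 ∂(volume.prod volume) ≤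
      ENNReal.ofReal S.E * S.totalExchange D := by
    refine (setLIntegral_le_lintegral _ _).trans ?_
    rw [lintegral_prod_mul (S.measurable_F_top s).aemeasurable mb.aemeasurable,
      lintegral_swap_exchange hm]
    gcongr
    exact S.lintegral_top_le s
  have h3 : ∫⁻ P in D, S.exchange D P.1 * ENNReal.ofReal (S.G P.1 P.2) ∂(volume.prod volume) ≤
      2 * ENNReal.ofReal S.E * S.totalExchange D := by
    refine (setLIntegral_le_lintegral _ _).trans ?_
    rw [lintegral_prod _ (ma.fun_mul S.measurable_ofReal_G).aemeasurable]
    calc _ = ∫⁻ X, S.exchange D X * ∫⁻ Y, ENNReal.ofReal (S.G X Y) := by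
          refine lintegral_congr fun X => ?_
          exact lintegral_const_mul (S.exchange D X) (f := fun Y => ENNReal.ofReal (S.G X Y))
            S.measurable_G.of_uncurry_left.ennreal_ofReal
      _ ≤ ∫⁻ X, S.exchange D X * (2 * ENNReal.ofReal S.E) := by
          gcongr with X
          exact S.lintegral_vertical_le X
      _ = _ := by
          rw [lintegral_mul_const _ (measurable_exchange hm), lintegral_exchange hm, mul_comm]
  refine h1.trans ?_
  rw [lintegral_add_left (mF.fun_mul mG),
    lintegral_add_left (mF.fun_mul mb')]
  refine add_le_add_right ((add_le_add h2 h3).trans (le_of_eq ?_)) _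
  ring

lemma lintegral_section_β (hst : s ≤ t) (X : ℝ) :
    ∫⁻ Y, {P : ℝ × ℝ | s < S.T P.1 P.2 ∧ S.T P.1 P.2 ≤ t}.indicator
      (fun P => ENNReal.ofReal (S.β P.1 P.2)) (X, Y) = ENNReal.ofReal (t - s) := by
  have h1 := (S.isPrimitive_T X).sub_eq (S.top s X) (S.top t X)
  rw [T_top, T_top, intervalIntegral.integral_of_le (S.top_mono hst X)] at h1
  rw [h1, ofReal_integral_eq_lintegral_ofReal, ← lintegral_indicator measurableSet_Ioc]
  · congr 1
    ext Y
    simp only [indicator, mem_ofPred_eq, mem_Ioc, top_lt_iff, le_top_iff]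
  · exact ((S.isPrimitive_T X).intervalIntegrable _ _).1
  · exact ae_restrict_of_ae (by filter_upwards [S.β_nonneg] with Y hY using hY X)

/-- Along a vertical section of the strip `t_Y = β` has integral `t - s`; so the product of `β` with
the energy of the other family is of order `t - s`. -/
lemma IsInitial.lintegral_β_mul_le (hD : S.IsInitial s t D) (hst : s ≤ t) :
    ∫⁻ P in D, ENNReal.ofReal (S.β P.1 P.2) * ENNReal.ofReal (S.F P.1 P.2)
      ∂(volume.prod volume) ≤
      (ENNReal.ofReal S.E + S.totalExchange D) * ENNReal.ofReal (t - s) := by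
  have hm := hD.measurableSet
  have mβ : Measurable fun P : ℝ × ℝ => ENNReal.ofReal (S.β P.1 P.2) :=
    S.measurable_β.ennreal_ofReal
  have mi := mβ.indicator (S.measurableSet_strip s t)
  have mA : Measurable fun X => ENNReal.ofReal (S.F X (S.top s X)) + S.exchange D X :=
    (S.measurable_F_top s).add (measurable_exchange hm)
  have mA' : Measurable fun P : ℝ × ℝ =>
      ENNReal.ofReal (S.F P.1 (S.top s P.1)) + S.exchange D P.1 := mA.comp measurable_fst
  calc _ ≤ ∫⁻ P in D, (ENNReal.ofReal (S.F P.1 (S.top s P.1)) + S.exchange D P.1) *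
          {P : ℝ × ℝ | s < S.T P.1 P.2 ∧ S.T P.1 P.2 ≤ t}.indicator
            (fun P => ENNReal.ofReal (S.β P.1 P.2)) P ∂(volume.prod volume) := by
        refine lintegral_mono_ae ?_
        filter_upwards [ae_restrict_of_ae (ae_fst hD.F_le), ae_restrict_mem hm] with P hF hP
        rw [indicator_of_mem (by exact hD.mem _ _ hP), mul_comm]
        gcongr
        exact hF _ hP
    _ ≤ ∫⁻ P, (ENNReal.ofReal (S.F P.1 (S.top s P.1)) + S.exchange D P.1) *
          {P : ℝ × ℝ | s < S.T P.1 P.2 ∧ S.T P.1 P.2 ≤ t}.indicator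
            (fun P => ENNReal.ofReal (S.β P.1 P.2)) P ∂(volume.prod volume) :=
        setLIntegral_le_lintegral _ _
    _ = ∫⁻ X, (ENNReal.ofReal (S.F X (S.top s X)) + S.exchange D X) * ENNReal.ofReal (t - s) := by
        rw [lintegral_prod _ (mA'.fun_mul mi).aemeasurable]
        refine lintegral_congr fun X => ?_
        rw [← lintegral_section_β (S := S) hst X]
        exact lintegral_const_mul (ENNReal.ofReal (S.F X (S.top s X)) + S.exchange D X)
          (f := fun Y => {P : ℝ × ℝ | s < S.T P.1 P.2 ∧ S.T P.1 P.2 ≤ t}.indicator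
            (fun P => ENNReal.ofReal (S.β P.1 P.2)) (X, Y)) (mi.comp measurable_prodMk_left)
    _ ≤ _ := by
        rw [lintegral_mul_const _ mA, lintegral_add_left (S.measurable_F_top s),
          lintegral_exchange hm]
        gcongr
        exact S.lintegral_top_le s

lemma IsInitial.lintegral_α_mul_le (hD : S.IsInitial s t D) (hst : s ≤ t) :
    ∫⁻ P in D, ENNReal.ofReal (S.α P.1 P.2) * ENNReal.ofReal (S.G P.1 P.2)
      ∂(volume.prod volume) ≤
      (ENNReal.ofReal S.E + S.totalExchange D) * ENNReal.ofReal (t - s) := by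
  have h := hD.swap.lintegral_β_mul_le hst
  rw [swap_totalExchange hD.measurableSet] at h
  refine le_trans (le_of_eq ?_) h
  exact (setLIntegral_swap hD.measurableSet fun P =>
    ENNReal.ofReal (S.α P.1 P.2) * ENNReal.ofReal (S.G P.1 P.2)).symm

lemma abs_sin_le {η : ℝ} (hη : 0 < η) (x : ℝ) :
    |Real.sin x| ≤ η * (1 - Real.cos x) + η⁻¹ * (1 + Real.cos x) := by
  have h1 : 0 ≤ 1 - Real.cos x := by linarith [Real.cos_le_one x]
  have h2 : 0 ≤ 1 + Real.cos x := by linarith [Real.neg_one_le_cos x]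
  have h3 : Real.sin x ^ 2 = (1 - Real.cos x) * (1 + Real.cos x) := by
    linarith [Real.sin_sq_add_cos_sq x]
  refine abs_le_of_sq_le_sq ?_ (by positivity)
  have h4 : η * η⁻¹ = 1 := mul_inv_cancel₀ hη.ne'
  have h5 : (η * (1 - Real.cos x) + η⁻¹ * (1 + Real.cos x)) ^ 2 =
      (η * (1 - Real.cos x)) ^ 2 + (η⁻¹ * (1 + Real.cos x)) ^ 2 +
        2 * (η * η⁻¹) * ((1 - Real.cos x) * (1 + Real.cos x)) := by ring
  rw [h3, h5, h4]
  have := mul_nonneg h1 h2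
  nlinarith [sq_nonneg (η * (1 - Real.cos x)), sq_nonneg (η⁻¹ * (1 + Real.cos x))]

variable (S) in
/-- The exchange term is a small multiple of the interaction `F G` plus terms that are of first
order in time. -/
lemma abs_h_le {η : ℝ} (hη : 0 < η) : ∀ᵐ P : ℝ × ℝ ∂(volume.prod volume),
    |S.h P.1 P.2| ≤ 16 * S.k₀ * η * (S.F P.1 P.2 * S.G P.1 P.2) +
      4 * S.k₀ * S.κ * η⁻¹ * (S.β P.1 P.2 * S.F P.1 P.2 + S.α P.1 P.2 * S.G P.1 P.2) := by
  filter_upwards [ae_fst S.p_pos, ae_snd S.q_pos] with ⟨X, Y⟩ hp hq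
  replace hp := hp Y
  replace hq := hq X
  simp only at hp hq ⊢
  have hk : |S.k X Y| ≤ S.k₀ := S.k_le _
  have hc := S.c_pos (S.u X Y)
  have hc2 := S.c_le (S.u X Y)
  have hsw := abs_sin_le hη (S.w X Y)
  have hsz := abs_sin_le hη (S.z X Y)
  have w1 : 0 ≤ 1 - Real.cos (S.w X Y) := by linarith [Real.cos_le_one (S.w X Y)]
  have w2 : 0 ≤ 1 + Real.cos (S.w X Y) := by linarith [Real.neg_one_le_cos (S.w X Y)]
  have z1 : 0 ≤ 1 - Real.cos (S.z X Y) := by linarith [Real.cos_le_one (S.z X Y)]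
  have z2 : 0 ≤ 1 + Real.cos (S.z X Y) := by linarith [Real.neg_one_le_cos (S.z X Y)]
  have hα : (1 + Real.cos (S.w X Y)) * S.p X Y ≤ 4 * S.κ * S.α X Y := by
    have h4 : (1 + Real.cos (S.w X Y)) * S.p X Y = 4 * S.c (S.u X Y) * S.α X Y := by
      simp only [α]; field_simp
    have h5 : 0 ≤ S.α X Y := by simp only [α]; positivity
    rw [h4]
    gcongr
  have hβ : (1 + Real.cos (S.z X Y)) * S.q X Y ≤ 4 * S.κ * S.β X Y := by
    have h4 : (1 + Real.cos (S.z X Y)) * S.q X Y = 4 * S.c (S.u X Y) * S.β X Y := by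
      simp only [β]; field_simp
    have h5 : 0 ≤ S.β X Y := by simp only [β]; positivity
    rw [h4]
    gcongr
  have hF : (1 - Real.cos (S.w X Y)) * S.p X Y = 8 * S.F X Y := by simp only [F]; ring
  have hG : (1 - Real.cos (S.z X Y)) * S.q X Y = 8 * S.G X Y := by simp only [G]; ring
  have hF0 : 0 ≤ S.F X Y := by simp only [F]; positivity
  have hG0 : 0 ≤ S.G X Y := by simp only [G]; positivity
  have hη' : 0 < η⁻¹ := inv_pos.2 hη
  have e1 : |Real.sin (S.z X Y) * (1 - Real.cos (S.w X Y)) -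
      Real.sin (S.w X Y) * (1 - Real.cos (S.z X Y))| * (S.p X Y * S.q X Y) ≤
      128 * η * (S.F X Y * S.G X Y) +
      32 * S.κ * η⁻¹ * (S.β X Y * S.F X Y + S.α X Y * S.G X Y) := by
    calc _ ≤ (|Real.sin (S.z X Y)| * (1 - Real.cos (S.w X Y)) +
          |Real.sin (S.w X Y)| * (1 - Real.cos (S.z X Y))) * (S.p X Y * S.q X Y) := by
          gcongr
          refine (abs_sub _ _).trans ?_
          rw [abs_mul, abs_mul, abs_of_nonneg w1, abs_of_nonneg z1]
      _ ≤ ((η * (1 - Real.cos (S.z X Y)) + η⁻¹ * (1 + Real.cos (S.z X Y))) *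
            (1 - Real.cos (S.w X Y)) +
          (η * (1 - Real.cos (S.w X Y)) + η⁻¹ * (1 + Real.cos (S.w X Y))) *
            (1 - Real.cos (S.z X Y))) * (S.p X Y * S.q X Y) := by gcongr
      _ = 2 * η * (((1 - Real.cos (S.w X Y)) * S.p X Y) * ((1 - Real.cos (S.z X Y)) * S.q X Y)) +
          η⁻¹ * (((1 + Real.cos (S.z X Y)) * S.q X Y) * ((1 - Real.cos (S.w X Y)) * S.p X Y) +
          ((1 + Real.cos (S.w X Y)) * S.p X Y) * ((1 - Real.cos (S.z X Y)) * S.q X Y)) := by ring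
      _ ≤ 2 * η * ((8 * S.F X Y) * (8 * S.G X Y)) +
          η⁻¹ * ((4 * S.κ * S.β X Y) * (8 * S.F X Y) + (4 * S.κ * S.α X Y) * (8 * S.G X Y)) := by
          rw [hF, hG]
          gcongr
      _ = _ := by ring
  calc |S.h X Y| = |S.k X Y| * (|Real.sin (S.z X Y) * (1 - Real.cos (S.w X Y)) -
      Real.sin (S.w X Y) * (1 - Real.cos (S.z X Y))| * (S.p X Y * S.q X Y)) / 8 := by
        rw [h, abs_div, abs_mul, abs_mul, abs_of_pos (mul_pos hp hq)]
        norm_num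
        ring
    _ ≤ S.k₀ * (128 * η * (S.F X Y * S.G X Y) +
      32 * S.κ * η⁻¹ * (S.β X Y * S.F X Y + S.α X Y * S.G X Y)) / 8 := by
        gcongr
        exact S.k₀_nonneg
    _ = _ := by ring

/-- A bound of the exchange by the interaction at the lower end of the strip and by the length of
the strip; the exchange reappears on the right with small factors. -/
lemma IsInitial.totalExchange_le (hD : S.IsInitial s t D) (hst : s ≤ t) {ε C : ℝ}
    (hε : 0 ≤ ε) (hC : 0 ≤ C)
    (hh : ∀ᵐ P : ℝ × ℝ ∂(volume.prod volume), |S.h P.1 P.2| ≤ ε * (S.F P.1 P.2 * S.G P.1 P.2) +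
      C * (S.β P.1 P.2 * S.F P.1 P.2 + S.α P.1 P.2 * S.G P.1 P.2)) :
    S.totalExchange D ≤ ENNReal.ofReal ε *
      (∫⁻ P in D, ENNReal.ofReal (S.F P.1 (S.top s P.1)) *
        ENNReal.ofReal (S.G (S.right s P.2) P.2) ∂(volume.prod volume) +
        3 * ENNReal.ofReal S.E * S.totalExchange D) +
      ENNReal.ofReal C * (2 * ((ENNReal.ofReal S.E + S.totalExchange D) *
        ENNReal.ofReal (t - s))) := by
  have mF := S.measurable_ofReal_F
  have mG := S.measurable_ofReal_G
  have mβ : Measurable fun P : ℝ × ℝ => ENNReal.ofReal (S.β P.1 P.2) :=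
    S.measurable_β.ennreal_ofReal
  have mα : Measurable fun P : ℝ × ℝ => ENNReal.ofReal (S.α P.1 P.2) :=
    S.measurable_α.ennreal_ofReal
  calc S.totalExchange D ≤ ∫⁻ P in D, (ENNReal.ofReal ε * (ENNReal.ofReal (S.F P.1 P.2) *
        ENNReal.ofReal (S.G P.1 P.2)) + ENNReal.ofReal C * (ENNReal.ofReal (S.β P.1 P.2) *
        ENNReal.ofReal (S.F P.1 P.2) + ENNReal.ofReal (S.α P.1 P.2) *
        ENNReal.ofReal (S.G P.1 P.2))) ∂(volume.prod volume) := by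
        refine lintegral_mono_ae (ae_restrict_of_ae ?_)
        filter_upwards [hh, ae_fst S.F_nonneg, ae_snd S.G_nonneg, ae_fst S.α_nonneg,
          ae_snd S.β_nonneg] with P hP hF hG hα hβ
        have hF := hF P.2
        have hG := hG P.1
        have hα := hα P.2
        have hβ := hβ P.1
        rw [← ENNReal.ofReal_mul hF, ← ENNReal.ofReal_mul hβ, ← ENNReal.ofReal_mul hα,
          ← ENNReal.ofReal_mul hε, ← ENNReal.ofReal_add (by positivity) (by positivity),
          ← ENNReal.ofReal_mul hC, ← ENNReal.ofReal_add (by positivity) (by positivity)]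
        exact ENNReal.ofReal_le_ofReal hP
    _ = ENNReal.ofReal ε * (∫⁻ P in D, ENNReal.ofReal (S.F P.1 P.2) *
        ENNReal.ofReal (S.G P.1 P.2) ∂(volume.prod volume)) + ENNReal.ofReal C *
        (∫⁻ P in D, ENNReal.ofReal (S.β P.1 P.2) * ENNReal.ofReal (S.F P.1 P.2)
          ∂(volume.prod volume) + ∫⁻ P in D, ENNReal.ofReal (S.α P.1 P.2) *
        ENNReal.ofReal (S.G P.1 P.2) ∂(volume.prod volume)) := by
        rw [lintegral_add_left ((mF.fun_mul mG).const_mul _), lintegral_const_mul _ (mF.fun_mul mG),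
          lintegral_const_mul _ ((mβ.fun_mul mF).fun_add (mα.fun_mul mG)),
          lintegral_add_left (mβ.fun_mul mF)]
    _ ≤ _ := by
        rw [two_mul]
        gcongr
        · exact hD.lintegral_mul_le
        · exact hD.lintegral_β_mul_le hst
        · exact hD.lintegral_α_mul_le hst

end CharSystem

namespace CharSystem

variable (S : CharSystem) {s t : ℝ} {D : Set (ℝ × ℝ)}

/-! ### The one-sided Lipschitz estimate -/

lemma potential_le_sq (τ : ℝ) : S.potential τ ≤ ENNReal.ofReal S.E * ENNReal.ofReal S.E := by
  refine (setLIntegral_le_lintegral _ _).trans ?_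
  rw [lintegral_prod_mul (S.measurable_F_top τ).aemeasurable
    (S.measurable_G_right τ).aemeasurable]
  exact mul_le_mul' (S.lintegral_top_le τ) (S.lintegral_right_le τ)

lemma potential_ne_top (τ : ℝ) : S.potential τ ≠ ⊤ :=
  ((S.potential_le_sq τ).trans_lt
    (ENNReal.mul_lt_top ENNReal.ofReal_lt_top ENNReal.ofReal_lt_top)).ne

/-- The interaction between the curves of times `s` and `t`, for the densities at time `s`. -/
noncomputable def lost (s t : ℝ) : ℝ≥0∞ :=
  ∫⁻ P in {P : ℝ × ℝ | s < S.T P.1 P.2 ∧ S.T P.1 P.2 ≤ t},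
    ENNReal.ofReal (S.F P.1 (S.top s P.1)) * ENNReal.ofReal (S.G (S.right s P.2) P.2)
      ∂(volume.prod volume)

lemma lost_le_potential : S.lost s t ≤ S.potential s :=
  lintegral_mono_set fun _ h => h.1

lemma isInitial_strip (s t : ℝ) :
    S.IsInitial s t {P : ℝ × ℝ | s < S.T P.1 P.2 ∧ S.T P.1 P.2 ≤ t} where
  measurableSet := S.measurableSet_strip s t
  mem _ _ h := h
  down X _ _ Y' h hX hY hs :=
    ⟨hs, ((S.T_mono_left Y' hX).trans (S.T_mono_right X hY)).trans h.2⟩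

/-- The part of the strip in a quadrant, in which the exchange is known beforehand to be finite. -/
lemma isInitial_cut (s t r : ℝ) :
    S.IsInitial s t ({P : ℝ × ℝ | s < S.T P.1 P.2 ∧ S.T P.1 P.2 ≤ t} ∩ Iic r ×ˢ Iic r) where
  measurableSet := (S.measurableSet_strip s t).inter (measurableSet_Iic.prod measurableSet_Iic)
  mem _ _ h := h.1
  down X Y X' Y' h hX hY hs :=
    ⟨(S.isInitial_strip s t).down X Y X' Y' h.1 hX hY hs, hX.trans h.2.1, hY.trans h.2.2⟩

/-- The cut strip is bounded: its points lie to the right of, and above, the points where the curve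
of time `s` meets the sides of the quadrant. -/
lemma totalExchange_cut_lt_top (s t r : ℝ) :
    S.totalExchange ({P : ℝ × ℝ | s < S.T P.1 P.2 ∧ S.T P.1 P.2 ≤ t} ∩ Iic r ×ˢ Iic r) < ⊤ := by
  have h := (S.locBdd_h.integrableOn S.measurable_h (S.right s r) r (S.top s r) r).2
  rw [hasFiniteIntegral_iff_enorm] at h
  refine lt_of_le_of_lt ?_ h
  rw [totalExchange]
  have e : ∀ P : ℝ × ℝ, ENNReal.ofReal |S.h P.1 P.2| = ‖Function.uncurry S.h P‖ₑ := fun P => by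
    rw [Real.enorm_eq_ofReal_abs]
    rfl
  simp only [e, Measure.volume_eq_prod]
  refine lintegral_mono_set ?_
  rintro ⟨X, Y⟩ ⟨⟨h1, h2⟩, hX, hY⟩
  simp only at h1 h2 hX hY
  refine ⟨⟨?_, hX⟩, ?_, hY⟩
  · exact ((S.right_lt_iff _ _ _).2 (h1.trans_le (S.T_mono_right X hY))).le
  · exact ((S.top_lt_iff _ _ _).2 (h1.trans_le (S.T_mono_left Y hX))).le

/-- The terms with `H` on the right are absorbed by the left-hand side, which is possible since `H`
is finite. -/
lemma absorb {H K : ℝ≥0∞} (hH : H ≠ ⊤) (hK : K ≠ ⊤) {ε C E δ : ℝ} (hε : 0 ≤ ε) (hC : 0 ≤ C)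
    (hE : 0 ≤ E) (hδ : 0 ≤ δ) (h1 : 3 * ε * E ≤ 1 / 4) (h2 : 2 * C * δ ≤ 1 / 4)
    (h : H ≤ ENNReal.ofReal ε * (K + 3 * ENNReal.ofReal E * H) +
      ENNReal.ofReal C * (2 * ((ENNReal.ofReal E + H) * ENNReal.ofReal δ))) :
    H ≤ ENNReal.ofReal (2 * ε) * K + ENNReal.ofReal (4 * C * E * δ) := by
  obtain ⟨x, hx, rfl⟩ : ∃ x : ℝ, 0 ≤ x ∧ H = ENNReal.ofReal x :=
    ⟨H.toReal, ENNReal.toReal_nonneg, (ENNReal.ofReal_toReal hH).symm⟩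
  obtain ⟨y, hy, rfl⟩ : ∃ y : ℝ, 0 ≤ y ∧ K = ENNReal.ofReal y :=
    ⟨K.toReal, ENNReal.toReal_nonneg, (ENNReal.ofReal_toReal hK).symm⟩
  rw [show (3 : ℝ≥0∞) = ENNReal.ofReal 3 by simp, show (2 : ℝ≥0∞) = ENNReal.ofReal 2 by simp,
    ← ENNReal.ofReal_mul (by norm_num), ← ENNReal.ofReal_mul (by positivity),
    ← ENNReal.ofReal_add hy (by positivity), ← ENNReal.ofReal_mul hε,
    ← ENNReal.ofReal_add hE hx, ← ENNReal.ofReal_mul (by positivity),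
    ← ENNReal.ofReal_mul (by norm_num), ← ENNReal.ofReal_mul hC,
    ← ENNReal.ofReal_add (by positivity) (by positivity),
    ENNReal.ofReal_le_ofReal_iff (by positivity)] at h
  rw [← ENNReal.ofReal_mul (by positivity), ← ENNReal.ofReal_add (by positivity) (by positivity)]
  refine ENNReal.ofReal_le_ofReal ?_
  nlinarith [mul_le_mul_of_nonneg_right h1 hx, mul_le_mul_of_nonneg_right h2 hx]

/-- In a short strip, the exchange of energy is controlled by a small multiple of the interaction
that is lost, and by the length of the strip. -/
lemma totalExchange_strip_le (hst : s ≤ t) {ε C : ℝ} (hε : 0 ≤ ε) (hC : 0 ≤ C)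
    (hh : ∀ᵐ P : ℝ × ℝ ∂(volume.prod volume), |S.h P.1 P.2| ≤ ε * (S.F P.1 P.2 * S.G P.1 P.2) +
      C * (S.β P.1 P.2 * S.F P.1 P.2 + S.α P.1 P.2 * S.G P.1 P.2))
    (h1 : 3 * ε * S.E ≤ 1 / 4) (h2 : 2 * C * (t - s) ≤ 1 / 4) :
    S.totalExchange {P : ℝ × ℝ | s < S.T P.1 P.2 ∧ S.T P.1 P.2 ≤ t} ≤
      ENNReal.ofReal (2 * ε) * S.lost s t + ENNReal.ofReal (4 * C * S.E * (t - s)) := by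
  have hU : {P : ℝ × ℝ | s < S.T P.1 P.2 ∧ S.T P.1 P.2 ≤ t} =
      ⋃ n : ℕ, {P : ℝ × ℝ | s < S.T P.1 P.2 ∧ S.T P.1 P.2 ≤ t} ∩ Iic (n : ℝ) ×ˢ Iic (n : ℝ) := by
    rw [← inter_iUnion, eq_comm, inter_eq_left]
    rintro ⟨X, Y⟩ -
    obtain ⟨n, hn⟩ := exists_nat_ge (max X Y)
    exact mem_iUnion.2 ⟨n, (le_max_left _ _).trans hn, (le_max_right _ _).trans hn⟩
  rw [hU, totalExchange, setLIntegral_iUnion_of_directed]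
  · refine iSup_le fun n => ?_
    have hK : S.lost s t ≠ ⊤ := (S.lost_le_potential.trans_lt (S.potential_ne_top s).lt_top).ne
    refine absorb (S.totalExchange_cut_lt_top s t n).ne hK hε hC S.E_nonneg
      (sub_nonneg.2 hst) h1 h2 ?_
    refine ((S.isInitial_cut s t n).totalExchange_le hst hε hC hh).trans ?_
    gcongr
    exact lintegral_mono_set inter_subset_left
  · refine (monotone_nat_of_le_succ fun n => ?_).directed_le
    have : (n : ℝ) ≤ (n + 1 : ℕ) := by simp
    exact inter_subset_inter_right _ (prod_mono (Iic_subset_Iic.2 this) (Iic_subset_Iic.2 this))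

/-- Balance of the interaction potential: the interaction in the strip is lost, and the exchange of
energy in the strip creates new interaction with at most the total energy. -/
lemma potential_add_lost_le (hst : s < t) :
    S.potential t + S.lost s t ≤ S.potential s + 2 * ENNReal.ofReal S.E *
      S.totalExchange {P : ℝ × ℝ | s < S.T P.1 P.2 ∧ S.T P.1 P.2 ≤ t} := by
  set D := {P : ℝ × ℝ | s < S.T P.1 P.2 ∧ S.T P.1 P.2 ≤ t} with hDdef
  have hD := S.isInitial_strip s t
  have hm := hD.measurableSet
  rw [← hDdef] at hD hm
  have ma : Measurable fun P : ℝ × ℝ => S.exchange D P.1 :=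
    (measurable_exchange hm).comp measurable_fst
  have mb : Measurable (S.swap.exchange (Prod.swap ⁻¹' D)) :=
    measurable_exchange (measurable_swap hm)
  have mb' : Measurable fun P : ℝ × ℝ => S.swap.exchange (Prod.swap ⁻¹' D) P.2 :=
    mb.comp measurable_snd
  have mF : Measurable fun P : ℝ × ℝ => ENNReal.ofReal (S.F P.1 (S.top s P.1)) :=
    (S.measurable_F_top s).comp measurable_fst
  have mG : Measurable fun P : ℝ × ℝ => ENNReal.ofReal (S.G (S.right s P.2) P.2) :=
    (S.measurable_G_right s).comp measurable_snd
  have mG' : Measurable fun P : ℝ × ℝ => ENNReal.ofReal (S.G (S.right t P.2) P.2) :=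
    (S.measurable_G_right t).comp measurable_snd
  have h1 : S.potential t ≤ ∫⁻ P in {P : ℝ × ℝ | t < S.T P.1 P.2},
      (ENNReal.ofReal (S.F P.1 (S.top s P.1)) * ENNReal.ofReal (S.G (S.right s P.2) P.2) +
        (ENNReal.ofReal (S.F P.1 (S.top s P.1)) * S.swap.exchange (Prod.swap ⁻¹' D) P.2 +
          S.exchange D P.1 * ENNReal.ofReal (S.G (S.right t P.2) P.2))) ∂(volume.prod volume) := by
    refine lintegral_mono_ae ?_
    filter_upwards [ae_restrict_of_ae (ae_fst hD.F_le), ae_restrict_of_ae (ae_snd hD.G_le)]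
      with P hF hG
    calc _ ≤ (ENNReal.ofReal (S.F P.1 (S.top s P.1)) + S.exchange D P.1) *
          ENNReal.ofReal (S.G (S.right t P.2) P.2) := by
          gcongr
          exact hF _ ⟨by simpa only [T_top] using hst, (S.T_top _ _).le⟩
      _ = ENNReal.ofReal (S.F P.1 (S.top s P.1)) * ENNReal.ofReal (S.G (S.right t P.2) P.2) +
          S.exchange D P.1 * ENNReal.ofReal (S.G (S.right t P.2) P.2) := add_mul _ _ _
      _ ≤ ENNReal.ofReal (S.F P.1 (S.top s P.1)) * (ENNReal.ofReal (S.G (S.right s P.2) P.2) +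
            S.swap.exchange (Prod.swap ⁻¹' D) P.2) +
          S.exchange D P.1 * ENNReal.ofReal (S.G (S.right t P.2) P.2) := by
          gcongr
          exact hG _ ⟨by simpa only [T_right] using hst, (S.T_right _ _).le⟩
      _ = _ := by rw [mul_add, add_assoc]
  rw [lintegral_add_left (mF.fun_mul mG), lintegral_add_left (mF.fun_mul mb')] at h1
  have h2 : ∫⁻ P in {P : ℝ × ℝ | t < S.T P.1 P.2}, ENNReal.ofReal (S.F P.1 (S.top s P.1)) *
      S.swap.exchange (Prod.swap ⁻¹' D) P.2 ∂(volume.prod volume) ≤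
      ENNReal.ofReal S.E * S.totalExchange D := by
    refine (setLIntegral_le_lintegral _ _).trans ?_
    rw [lintegral_prod_mul (S.measurable_F_top s).aemeasurable mb.aemeasurable,
      lintegral_swap_exchange hm]
    gcongr
    exact S.lintegral_top_le s
  have h3 : ∫⁻ P in {P : ℝ × ℝ | t < S.T P.1 P.2}, S.exchange D P.1 *
      ENNReal.ofReal (S.G (S.right t P.2) P.2) ∂(volume.prod volume) ≤
      ENNReal.ofReal S.E * S.totalExchange D := by
    refine (setLIntegral_le_lintegral _ _).trans ?_
    rw [lintegral_prod_mul (measurable_exchange hm).aemeasurable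
      (S.measurable_G_right t).aemeasurable, lintegral_exchange hm, mul_comm]
    gcongr
    exact S.lintegral_right_le t
  have h4 : ∫⁻ P in {P : ℝ × ℝ | t < S.T P.1 P.2}, ENNReal.ofReal (S.F P.1 (S.top s P.1)) *
      ENNReal.ofReal (S.G (S.right s P.2) P.2) ∂(volume.prod volume) + S.lost s t =
      S.potential s := by
    rw [lost, ← lintegral_union hm]
    · rw [potential]
      congr 2
      ext P
      simp only [hDdef, mem_union, mem_ofPred_eq]
      grind
    · rw [Set.disjoint_left]
      exact fun P hP hP' => absurd hP'.2 (not_le.2 hP)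
  calc S.potential t + S.lost s t ≤ _ := add_le_add_left (h1.trans (add_le_add_right
        (add_le_add h2 h3) _)) _
    _ = _ := by
      rw [← h4]
      ring

/-- The interaction potential increases at most linearly over short intervals of time. -/
lemma exists_potential_le : ∃ δ > 0, ∃ L ≥ 0, ∀ s t, s < t → t - s ≤ δ →
    S.potential t ≤ S.potential s + ENNReal.ofReal (L * (t - s)) := by
  have hE := S.E_nonneg
  have hk := S.k₀_nonneg
  have hκ := S.κ_pos
  -- The constant `ε` makes the newly created interaction smaller than the lost one.
  set ε := (12 * (S.E + 1))⁻¹ with hε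
  have hε0 : 0 < ε := by positivity
  have hεE : ε * S.E ≤ 1 / 12 := by
    rw [hε, inv_mul_le_iff₀ (by positivity)]
    linarith
  set η := ε / (16 * (S.k₀ + 1)) with hη
  have hη0 : 0 < η := by positivity
  have hηε : 16 * S.k₀ * η ≤ ε := by
    have h1 : 16 * (S.k₀ + 1) * η = ε := by
      rw [hη]
      field_simp
    linarith
  set C := 4 * S.k₀ * S.κ * η⁻¹ with hC
  have hC0 : 0 ≤ C := by positivity
  refine ⟨(8 * (C + 1))⁻¹, by positivity, 8 * C * S.E ^ 2, by positivity, fun s t hst hδ => ?_⟩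
  have hh : ∀ᵐ P : ℝ × ℝ ∂(volume.prod volume), |S.h P.1 P.2| ≤
      ε * (S.F P.1 P.2 * S.G P.1 P.2) +
      C * (S.β P.1 P.2 * S.F P.1 P.2 + S.α P.1 P.2 * S.G P.1 P.2) := by
    filter_upwards [S.abs_h_le hη0, ae_fst S.F_nonneg, ae_snd S.G_nonneg] with P hP hF hG
    refine hP.trans (add_le_add_left ?_ _)
    exact mul_le_mul_of_nonneg_right hηε (mul_nonneg (hF _) (hG _))
  have hCδ : 2 * C * (t - s) ≤ 1 / 4 := by
    have h1 : 8 * (C + 1) * (t - s) ≤ 1 := by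
      rw [← le_inv_mul_iff₀ (by positivity), mul_one]
      exact hδ
    linarith
  have h1 := S.totalExchange_strip_le hst.le hε0.le hC0 hh (by linarith) hCδ
  have h2 := S.potential_add_lost_le hst
  have hlost : S.lost s t ≠ ⊤ := (S.lost_le_potential.trans_lt (S.potential_ne_top s).lt_top).ne
  refine (ENNReal.add_le_add_iff_right hlost).1 (h2.trans ?_)
  have hts : 0 ≤ t - s := by linarith
  calc _ ≤ S.potential s + 2 * ENNReal.ofReal S.E * (ENNReal.ofReal (2 * ε) * S.lost s t +
        ENNReal.ofReal (4 * C * S.E * (t - s))) := by gcongr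
    _ = S.potential s + (ENNReal.ofReal (2 * S.E * (2 * ε)) * S.lost s t +
        ENNReal.ofReal (8 * C * S.E ^ 2 * (t - s))) := by
      rw [show (2 : ℝ≥0∞) = ENNReal.ofReal 2 by simp, ← ENNReal.ofReal_mul (by norm_num),
        mul_add, ← mul_assoc, ← ENNReal.ofReal_mul (by positivity),
        ← ENNReal.ofReal_mul (by positivity)]
      congr 3
      ring_nf
    _ ≤ S.potential s + (1 * S.lost s t + ENNReal.ofReal (8 * C * S.E ^ 2 * (t - s))) := by
      gcongr
      rw [← ENNReal.ofReal_one]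
      exact ENNReal.ofReal_le_ofReal (by linarith)
    _ = _ := by rw [one_mul]; ring

/-- The interaction potential increases at most linearly. -/
lemma exists_toReal_potential_sub_le : ∃ L ≥ 0, ∀ s t, s ≤ t →
    (S.potential t).toReal - (S.potential s).toReal ≤ L * (t - s) := by
  obtain ⟨δ, hδ, L, hL, h⟩ := S.exists_potential_le
  have short : ∀ s t, s < t → t - s ≤ δ →
      (S.potential t).toReal - (S.potential s).toReal ≤ L * (t - s) := by
    intro s t hst hts
    have h1 := ENNReal.toReal_mono (by simp [S.potential_ne_top s]) (h s t hst hts)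
    have h0 : 0 ≤ L * (t - s) := mul_nonneg hL (by linarith)
    rw [ENNReal.toReal_add (S.potential_ne_top s) (by simp), ENNReal.toReal_ofReal h0] at h1
    linarith
  have steps : ∀ n : ℕ, ∀ s t, s ≤ t → t - s ≤ n * δ →
      (S.potential t).toReal - (S.potential s).toReal ≤ L * (t - s) := by
    intro n
    induction n with
    | zero =>
      intro s t hst hts
      have : s = t := by
        simp only [Nat.cast_zero, zero_mul] at hts
        linarith
      simp [this]
    | succ n ih =>
      intro s t hst hts
      push_cast at hts
      rcases le_or_gt (t - s) δ with h1 | h1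
      · rcases hst.eq_or_lt with rfl | h2
        · simp
        · exact short s t h2 h1
      · have h2 := short s (s + δ) (by linarith) (by linarith)
        have h3 := ih (s + δ) t (by linarith) (by linarith)
        linarith
  refine ⟨L, hL, fun s t hst => ?_⟩
  obtain ⟨n, hn⟩ := exists_nat_ge ((t - s) / δ)
  exact steps n s t hst ((div_le_iff₀ hδ).1 hn)

end CharSystem

/-! ### Stretching the line by a density -/

/-- A locally integrable density `ρ ≥ 1`. -/
structure IsStretch (ρ : ℝ → ℝ) : Prop where
  intervalIntegrable : ∀ a b, IntervalIntegrable ρ volume a b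
  aemeasurable : AEMeasurable ρ volume
  one_le : ∀ x, 1 ≤ ρ x

/-- The stretched coordinate `∫₀ˣ ρ`. -/
noncomputable def stretch (ρ : ℝ → ℝ) (x : ℝ) : ℝ := ∫ y in (0 : ℝ)..x, ρ y

namespace IsStretch

variable {ρ : ℝ → ℝ}

lemma sub_eq (h : IsStretch ρ) (a b : ℝ) : stretch ρ b - stretch ρ a = ∫ y in a..b, ρ y :=
  intervalIntegral.integral_interval_sub_left (h.intervalIntegrable _ _)
    (h.intervalIntegrable _ _)

lemma sub_le (h : IsStretch ρ) {a b : ℝ} (hab : a ≤ b) : b - a ≤ stretch ρ b - stretch ρ a := by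
  rw [h.sub_eq]
  have := intervalIntegral.integral_mono_on hab (f := fun _ => (1 : ℝ)) (by simp)
    (h.intervalIntegrable a b) fun x _ => h.one_le x
  simpa using this

lemma strictMono (h : IsStretch ρ) : StrictMono (stretch ρ) := fun a b hab => by
  linarith [h.sub_le hab.le]

lemma continuous (h : IsStretch ρ) : Continuous (stretch ρ) :=
  intervalIntegral.continuous_primitive h.intervalIntegrable 0

lemma bijective (h : IsStretch ρ) : Function.Bijective (stretch ρ) := by
  refine ⟨h.strictMono.injective, h.continuous.surjective ?_ ?_⟩
  · refine Filter.tendsto_atTop_mono' _ ?_ Filter.tendsto_id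
    filter_upwards [Filter.eventually_ge_atTop 0] with x hx
    have := h.sub_le hx
    simp only [stretch, intervalIntegral.integral_same] at this
    simpa [stretch] using this
  · refine Filter.tendsto_atBot_mono' _ ?_ Filter.tendsto_id
    filter_upwards [Filter.eventually_le_atBot 0] with x hx
    have := h.sub_le hx
    simp only [stretch, intervalIntegral.integral_same] at this
    simp only [stretch, id]
    linarith

lemma stretch_invFun (h : IsStretch ρ) (X : ℝ) : stretch ρ (Function.invFun (stretch ρ) X) = X :=
  Function.rightInverse_invFun h.bijective.2 X

lemma invFun_stretch (h : IsStretch ρ) (x : ℝ) : Function.invFun (stretch ρ) (stretch ρ x) = x :=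
  Function.leftInverse_invFun h.bijective.1 x

lemma preimage_Ioc (h : IsStretch ρ) (a b : ℝ) :
    stretch ρ ⁻¹' Ioc (stretch ρ a) (stretch ρ b) = Ioc a b := by
  ext x
  simp [h.strictMono.lt_iff_lt, h.strictMono.le_iff_le]

/-- The stretched coordinate carries the measure of density `ρ` to the Lebesgue measure. -/
lemma map_eq (h : IsStretch ρ) :
    (volume.withDensity fun x => ENNReal.ofReal (ρ x)).map (stretch ρ) = volume := by
  have hv : ∀ a b, a < b → (volume.withDensity fun x => ENNReal.ofReal (ρ x)).map (stretch ρ)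
      (Ioc a b) = volume (Ioc a b) := by
    intro a b hab
    obtain ⟨x, rfl⟩ := h.bijective.2 a
    obtain ⟨y, rfl⟩ := h.bijective.2 b
    have hxy := (h.strictMono.lt_iff_lt.1 hab).le
    rw [Measure.map_apply h.continuous.measurable measurableSet_Ioc, h.preimage_Ioc,
      withDensity_apply _ measurableSet_Ioc, Real.volume_Ioc, h.sub_eq,
      intervalIntegral.integral_of_le hxy, ofReal_integral_eq_lintegral_ofReal
        (h.intervalIntegrable x y).1 (.of_forall fun z => zero_le_one.trans (h.one_le z))]
  refine Measure.ext_of_Ioc' _ _ (fun a b hab => ?_) hv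
  rw [hv a b hab]
  simp

lemma ae_comp (h : IsStretch ρ) {Q : ℝ → Prop} (hQ : ∀ᵐ X, Q X) : ∀ᵐ x, Q (stretch ρ x) := by
  have h1 : ∀ᵐ x ∂(volume.withDensity fun x => ENNReal.ofReal (ρ x)), Q (stretch ρ x) := by
    rw [← h.map_eq] at hQ
    exact ae_of_ae_map h.continuous.measurable.aemeasurable hQ
  refine (withDensity_absolutelyContinuous' h.aemeasurable.ennreal_ofReal ?_).ae_le h1
  exact .of_forall fun x => by simpa using zero_lt_one.trans_le (h.one_le x)

lemma lintegral_eq (h : IsStretch ρ) {g : ℝ → ℝ≥0∞} (hg : Measurable g) :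
    ∫⁻ X, g X = ∫⁻ x, ENNReal.ofReal (ρ x) * g (stretch ρ x) := by
  have h1 := lintegral_map (μ := volume.withDensity fun x => ENNReal.ofReal (ρ x)) hg
    h.continuous.measurable
  rw [h.map_eq] at h1
  exact h1.trans (lintegral_withDensity_eq_lintegral_mul₀ h.aemeasurable.ennreal_ofReal
    (hg.comp h.continuous.measurable).aemeasurable)

lemma integral_eq (h : IsStretch ρ) {g : ℝ → ℝ} (hg : Measurable g) (a b : ℝ) :
    ∫ X in (stretch ρ a)..(stretch ρ b), g X = ∫ x in a..b, ρ x * g (stretch ρ x) := by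
  wlog hab : a ≤ b generalizing a b
  · rw [intervalIntegral.integral_symm, this b a (le_of_not_ge hab),
      ← intervalIntegral.integral_symm]
  rw [intervalIntegral.integral_of_le hab,
    intervalIntegral.integral_of_le (h.strictMono.monotone hab)]
  have h1 := setIntegral_map (μ := volume.withDensity fun x => ENNReal.ofReal (ρ x))
    (g := stretch ρ) (f := g) (s := Ioc (stretch ρ a) (stretch ρ b)) measurableSet_Ioc
    hg.aestronglyMeasurable h.continuous.measurable.aemeasurable
  rw [h.map_eq, h.preimage_Ioc, setIntegral_withDensity_eq_setIntegral_toReal_smul₀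
    h.aemeasurable.ennreal_ofReal.restrict (by simp) _ measurableSet_Ioc] at h1
  rw [h1]
  refine integral_congr_ae (.of_forall fun x => ?_)
  simp [ENNReal.toReal_ofReal (zero_le_one.trans (h.one_le x))]

end IsStretch

namespace CharSystem

variable (S : CharSystem)

/-! ### The position -/

/-- The derivative `x_X`. -/
noncomputable def xX (X Y : ℝ) : ℝ := (1 + Real.cos (S.w X Y)) * S.p X Y / 4

/-- The derivative `-x_Y`. -/
noncomputable def xY (X Y : ℝ) : ℝ := (1 + Real.cos (S.z X Y)) * S.q X Y / 4

lemma measurable_xX : Measurable (Function.uncurry S.xX) :=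
  ((measurable_const.add (Real.measurable_cos.comp S.measurable_w)).mul S.measurable_p).div_const 4

lemma measurable_xY : Measurable (Function.uncurry S.xY) :=
  ((measurable_const.add (Real.measurable_cos.comp S.measurable_z)).mul S.measurable_q).div_const 4

lemma locBdd_xX : LocBdd₂ S.xX := by
  have := (LocBdd₂.of_bound (f := fun X Y => (1 + Real.cos (S.w X Y)) / 4) (C := 2)
    fun X Y => by
      rw [abs_div]
      have := abs_one_add_cos_le (S.w X Y)
      norm_num
      linarith).mul S.locBdd_p
  convert! this using 3
  simp only [xX]; ring

lemma locBdd_xY : LocBdd₂ S.xY := S.swap.locBdd_xX.flip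

/-- The form `dx = x_X dX + x_Y dY` is closed. -/
lemma pos_closed (X Y : ℝ) :
    (∫ X' in (S.ψ Y)..X, S.xX X' Y) + (∫ Y' in (S.φ X)..Y, S.xY X Y') =
      (∫ X' in (S.ψ Y)..X, S.xX X' (S.φ X')) + ∫ Y' in (S.φ X)..Y, S.xY (S.ψ Y') Y' := by
  have hg : ∀ᵐ Y, IsPrimitive (fun X => -S.xY X Y) fun X => S.posXY X Y := by
    filter_upwards [S.swap.isPrimitive_cα] with Y hY
    refine ((IsPrimitive.const (-1)).mul hY).congr (fun X => ?_) fun X => ?_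
    · simp [xY]
    · simp [swap_posXY]
  have h := S.closed_form S.measurable_posXY S.locBdd_posXY S.isPrimitive_cα hg X Y
  have hβ : IntervalIntegrable (fun Y' => S.xY (S.ψ Y') Y') volume (S.φ X) Y :=
    S.swap.intervalIntegrable_base S.swap.measurable_xX S.swap.locBdd_xX _ _
  have h1 : ∫ X' in (S.ψ Y)..X, (S.xX X' Y - S.xX X' (S.φ X')) =
      -∫ Y' in (S.φ X)..Y, (S.xY X Y' - S.xY (S.ψ Y') Y') := by
    rw [← intervalIntegral.integral_neg]
    refine h.trans (intervalIntegral.integral_congr fun Y' _ => ?_)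
    ring
  rw [intervalIntegral.integral_sub (S.locBdd_xX.intervalIntegrable_left S.measurable_xX _ _ _)
      (S.intervalIntegrable_base S.measurable_xX S.locBdd_xX _ _),
    intervalIntegral.integral_sub
      (S.locBdd_xY.intervalIntegrable_right S.measurable_xY _ _ _) hβ] at h1
  linarith

end CharSystem

/-! ### The characteristic system of a solution -/

section Concrete

variable {c u0 u1 : ℝ → ℝ} {κ : ℝ}

lemma IsWaveSpeed.pos (hc : IsWaveSpeed c κ) (v : ℝ) : 0 < c v :=
  (inv_pos.2 (zero_lt_one.trans hc.one_lt)).trans_le (hc.lower v)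

lemma IsWaveData.continuous (hd : IsWaveData u0 u1) : Continuous u0 := by
  rw [continuous_iff_continuousAt]
  intro x
  have := (hd.absCont (x - 1) (x + 1)).continuousOn
  rw [uIcc_of_le (by linarith)] at this
  exact this.continuousAt (Icc_mem_nhds (by linarith) (by linarith))

lemma memLp_c_mul (hc : IsWaveSpeed c κ) (hd : IsWaveData u0 u1) :
    MemLp (fun x => c (u0 x) * deriv u0 x) 2 volume := by
  refine MemLp.of_le_mul (c := κ) hd.deriv_memLp
    (((hc.smooth.continuous.comp hd.continuous).aestronglyMeasurable).mul
      hd.deriv_memLp.1) (.of_forall fun x => ?_)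
  rw [norm_mul, Real.norm_eq_abs (c (u0 x)), abs_of_pos (hc.pos _)]
  exact mul_le_mul_of_nonneg_right (hc.upper _) (norm_nonneg _)

lemma memLp_R0 (hc : IsWaveSpeed c κ) (hd : IsWaveData u0 u1) :
    MemLp (R0 c u0 u1) 2 volume := hd.memLp.add (memLp_c_mul hc hd)

lemma memLp_S0 (hc : IsWaveSpeed c κ) (hd : IsWaveData u0 u1) :
    MemLp (S0 c u0 u1) 2 volume := hd.memLp.sub (memLp_c_mul hc hd)

lemma isStretch_of_memLp {f : ℝ → ℝ} (hf : MemLp f 2 volume) :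
    IsStretch fun x => 1 + f x ^ 2 where
  intervalIntegrable a b := by
    have h1 : IntervalIntegrable (fun x => f x ^ 2) volume a b :=
      hf.integrable_sq.intervalIntegrable
    exact intervalIntegrable_const.add h1
  aemeasurable := (hf.1.aemeasurable.pow_const 2).const_add 1
  one_le x := by nlinarith [sq_nonneg (f x)]

lemma curveY_eq (x : ℝ) : curveY c u0 u1 x = -stretch (fun x => 1 + S0 c u0 u1 x ^ 2) x :=
  intervalIntegral.integral_symm _ _

lemma isStretch_R0 (hc : IsWaveSpeed c κ) (hd : IsWaveData u0 u1) :
    IsStretch fun x => 1 + R0 c u0 u1 x ^ 2 := isStretch_of_memLp (memLp_R0 hc hd)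

lemma isStretch_S0 (hc : IsWaveSpeed c κ) (hd : IsWaveData u0 u1) :
    IsStretch fun x => 1 + S0 c u0 u1 x ^ 2 := isStretch_of_memLp (memLp_S0 hc hd)

lemma curveY_bijective (hc : IsWaveSpeed c κ) (hd : IsWaveData u0 u1) :
    Function.Bijective (curveY c u0 u1) := by
  have : curveY c u0 u1 = Neg.neg ∘ stretch (fun x => 1 + S0 c u0 u1 x ^ 2) := by
    funext x
    exact curveY_eq x
  rw [this]
  exact (Equiv.neg ℝ).bijective.comp (isStretch_S0 hc hd).bijective

lemma curveX_footX (hc : IsWaveSpeed c κ) (hd : IsWaveData u0 u1) (X : ℝ) :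
    stretch (fun x => 1 + R0 c u0 u1 x ^ 2) (footX c u0 u1 X) = X :=
  (isStretch_R0 hc hd).stretch_invFun X

lemma footX_curveX (hc : IsWaveSpeed c κ) (hd : IsWaveData u0 u1) (x : ℝ) :
    footX c u0 u1 (stretch (fun x => 1 + R0 c u0 u1 x ^ 2) x) = x :=
  (isStretch_R0 hc hd).invFun_stretch x

lemma curveY_footY (hc : IsWaveSpeed c κ) (hd : IsWaveData u0 u1) (Y : ℝ) :
    curveY c u0 u1 (footY c u0 u1 Y) = Y :=
  Function.rightInverse_invFun (curveY_bijective hc hd).2 Y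

lemma footY_curveY (hc : IsWaveSpeed c κ) (hd : IsWaveData u0 u1) (x : ℝ) :
    footY c u0 u1 (curveY c u0 u1 x) = x :=
  Function.leftInverse_invFun (curveY_bijective hc hd).1 x

lemma curveY_lt_iff (hc : IsWaveSpeed c κ) (hd : IsWaveData u0 u1) (x y : ℝ) :
    curveY c u0 u1 x < curveY c u0 u1 y ↔ y < x := by
  rw [curveY_eq, curveY_eq, neg_lt_neg_iff, (isStretch_S0 hc hd).strictMono.lt_iff_lt]

lemma curveX_lt_iff (hc : IsWaveSpeed c κ) (hd : IsWaveData u0 u1) (x y : ℝ) :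
    curveX c u0 u1 x < curveX c u0 u1 y ↔ x < y :=
  (isStretch_R0 hc hd).strictMono.lt_iff_lt

lemma phi_lt_iff (hc : IsWaveSpeed c κ) (hd : IsWaveData u0 u1) (X Y : ℝ) :
    phi c u0 u1 X < Y ↔ phiInv c u0 u1 Y < X := by
  have h1 := curveY_lt_iff hc hd (footX c u0 u1 X) (footY c u0 u1 Y)
  have h2 := curveX_lt_iff hc hd (footY c u0 u1 Y) (footX c u0 u1 X)
  rw [curveY_footY hc hd] at h1
  rw [show curveX c u0 u1 (footX c u0 u1 X) = X from curveX_footX hc hd X] at h2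
  exact h1.trans h2.symm

lemma lt_phi_iff (hc : IsWaveSpeed c κ) (hd : IsWaveData u0 u1) (X Y : ℝ) :
    Y < phi c u0 u1 X ↔ X < phiInv c u0 u1 Y := by
  have h1 := curveY_lt_iff hc hd (footY c u0 u1 Y) (footX c u0 u1 X)
  have h2 := curveX_lt_iff hc hd (footX c u0 u1 X) (footY c u0 u1 Y)
  rw [curveY_footY hc hd] at h1
  rw [show curveX c u0 u1 (footX c u0 u1 X) = X from curveX_footX hc hd X] at h2
  exact h1.trans h2.symm

lemma phi_curveX (hc : IsWaveSpeed c κ) (hd : IsWaveData u0 u1) (x : ℝ) :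
    phi c u0 u1 (stretch (fun x => 1 + R0 c u0 u1 x ^ 2) x) = curveY c u0 u1 x := by
  rw [phi, footX_curveX hc hd]

lemma phiInv_curveY (hc : IsWaveSpeed c κ) (hd : IsWaveData u0 u1) (x : ℝ) :
    phiInv c u0 u1 (curveY c u0 u1 x) = curveX c u0 u1 x := by
  rw [phiInv, footY_curveY hc hd]

lemma one_add_cos_two_arctan (r : ℝ) :
    (1 + r ^ 2) * (1 + Real.cos (2 * Real.arctan r)) = 2 := by
  have : 1 + r ^ 2 ≠ 0 := by positivity
  rw [Real.cos_two_mul, Real.cos_sq_arctan]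
  field_simp
  ring

lemma one_sub_cos_two_arctan (r : ℝ) :
    (1 + r ^ 2) * (1 - Real.cos (2 * Real.arctan r)) = 2 * r ^ 2 := by
  linarith [one_add_cos_two_arctan r]

variable {w z p q u : ℝ → ℝ → ℝ}

lemma antitone_phi (hc : IsWaveSpeed c κ) (hd : IsWaveData u0 u1) : Antitone (phi c u0 u1) := by
  intro X X' h
  by_contra! hlt
  have h1 := (phi_lt_iff hc hd X _).1 hlt
  have h2 : ¬ phiInv c u0 u1 (phi c u0 u1 X') < X' := fun hh =>
    lt_irrefl _ ((phi_lt_iff hc hd X' _).2 hh)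
  exact h2 (h1.trans_le h)

lemma antitone_phiInv (hc : IsWaveSpeed c κ) (hd : IsWaveData u0 u1) :
    Antitone (phiInv c u0 u1) := by
  intro Y Y' h
  by_contra! hlt
  have h1 := (lt_phi_iff hc hd _ Y').2 hlt
  have h2 : ¬ Y < phi c u0 u1 (phiInv c u0 u1 Y) := fun hh =>
    lt_irrefl _ ((lt_phi_iff hc hd _ Y).1 hh)
  exact h2 (h.trans_lt h1)

/-- The data are attained at the point of `γ` of parameter `x` for almost every `x`: as the curve is
parametrized with a density `≥ 1`, an exceptional null set of abscissae has a null set of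
parameters. -/
lemma base_values_w (hc : IsWaveSpeed c κ) (hd : IsWaveData u0 u1)
    (hs : IsCharSolution c u0 u1 w z p q u) : ∀ᵐ x,
    w (curveX c u0 u1 x) (curveY c u0 u1 x) = 2 * Real.arctan (R0 c u0 u1 x) ∧
    p (curveX c u0 u1 x) (curveY c u0 u1 x) = 1 := by
  have h1 : ∀ᵐ X, w X (phi c u0 u1 X) = 2 * Real.arctan (R0 c u0 u1 (footX c u0 u1 X)) ∧
      p X (phi c u0 u1 X) = 1 := by
    filter_upwards [hs.eq_w, hs.eq_p] with X hw hp
    exact ⟨by simpa using hw (phi c u0 u1 X), by simpa using hp (phi c u0 u1 X)⟩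
  filter_upwards [(isStretch_R0 hc hd).ae_comp h1] with x hx
  rwa [phi_curveX hc hd, footX_curveX hc hd] at hx

lemma base_values_z (hc : IsWaveSpeed c κ) (hd : IsWaveData u0 u1)
    (hs : IsCharSolution c u0 u1 w z p q u) : ∀ᵐ x,
    z (curveX c u0 u1 x) (curveY c u0 u1 x) = 2 * Real.arctan (S0 c u0 u1 x) ∧
    q (curveX c u0 u1 x) (curveY c u0 u1 x) = 1 := by
  have h1 : ∀ᵐ Y, z (phiInv c u0 u1 Y) Y = 2 * Real.arctan (S0 c u0 u1 (footY c u0 u1 Y)) ∧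
      q (phiInv c u0 u1 Y) Y = 1 := by
    filter_upwards [hs.eq_z, hs.eq_q] with Y hz hq
    exact ⟨by simpa using hz (phiInv c u0 u1 Y), by simpa using hq (phiInv c u0 u1 Y)⟩
  filter_upwards [(isStretch_S0 hc hd).ae_comp (ae_comp_neg h1)] with x hx
  rwa [← curveY_eq, phiInv_curveY hc hd, footY_curveY hc hd] at hx

/-- Integrals along the base curve in the variable `X`, in terms of the parameter of the curve. -/
lemma integral_base_X (hc : IsWaveSpeed c κ) (hd : IsWaveData u0 u1) {g : ℝ → ℝ → ℝ}
    (hg : Measurable (Function.uncurry g)) (X Y : ℝ) :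
    ∫ X' in (phiInv c u0 u1 Y)..X, g X' (phi c u0 u1 X') =
      ∫ x in (footY c u0 u1 Y)..(footX c u0 u1 X),
        (1 + R0 c u0 u1 x ^ 2) * g (curveX c u0 u1 x) (curveY c u0 u1 x) := by
  have hm : Measurable fun X' => g X' (phi c u0 u1 X') :=
    hg.comp (measurable_id.prodMk (antitone_phi hc hd).measurable)
  have h := (isStretch_R0 hc hd).integral_eq hm (footY c u0 u1 Y) (footX c u0 u1 X)
  simp only [phi_curveX hc hd, curveX_footX hc hd] at h
  exact h

lemma integral_base_Y (hc : IsWaveSpeed c κ) (hd : IsWaveData u0 u1) {g : ℝ → ℝ → ℝ}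
    (hg : Measurable (Function.uncurry g)) (X Y : ℝ) :
    ∫ Y' in (phi c u0 u1 X)..Y, g (phiInv c u0 u1 Y') Y' =
      ∫ x in (footY c u0 u1 Y)..(footX c u0 u1 X),
        (1 + S0 c u0 u1 x ^ 2) * g (curveX c u0 u1 x) (curveY c u0 u1 x) := by
  have hm : Measurable fun Y' => g (phiInv c u0 u1 (-Y')) (-Y') :=
    hg.comp (((antitone_phiInv hc hd).measurable.comp measurable_neg).prodMk measurable_neg)
  have h := (isStretch_S0 hc hd).integral_eq hm (footY c u0 u1 Y) (footX c u0 u1 X)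
  simp only [← curveY_eq, phiInv_curveY hc hd] at h
  rw [← h, intervalIntegral.integral_comp_neg (fun Y' => g (phiInv c u0 u1 Y') Y'), ← curveY_eq,
    ← curveY_eq, curveY_footY hc hd]
  rfl

lemma lintegral_base_X (hc : IsWaveSpeed c κ) (hd : IsWaveData u0 u1) {g : ℝ → ℝ → ℝ}
    (hg : Measurable (Function.uncurry g)) :
    ∫⁻ X, ENNReal.ofReal (g X (phi c u0 u1 X)) =
      ∫⁻ x, ENNReal.ofReal ((1 + R0 c u0 u1 x ^ 2) * g (curveX c u0 u1 x) (curveY c u0 u1 x)) := by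
  have hm : Measurable fun X' => ENNReal.ofReal (g X' (phi c u0 u1 X')) :=
    (hg.comp (measurable_id.prodMk (antitone_phi hc hd).measurable)).ennreal_ofReal
  rw [(isStretch_R0 hc hd).lintegral_eq hm]
  refine lintegral_congr fun x => ?_
  rw [phi_curveX hc hd, ← ENNReal.ofReal_mul (by positivity)]
  rfl

lemma lintegral_base_Y (hc : IsWaveSpeed c κ) (hd : IsWaveData u0 u1) {g : ℝ → ℝ → ℝ}
    (hg : Measurable (Function.uncurry g)) :
    ∫⁻ Y, ENNReal.ofReal (g (phiInv c u0 u1 Y) Y) =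
      ∫⁻ x, ENNReal.ofReal ((1 + S0 c u0 u1 x ^ 2) * g (curveX c u0 u1 x) (curveY c u0 u1 x)) := by
  have hm : Measurable fun Y' => ENNReal.ofReal (g (phiInv c u0 u1 (-Y')) (-Y')) :=
    (hg.comp (((antitone_phiInv hc hd).measurable.comp measurable_neg).prodMk
      measurable_neg)).ennreal_ofReal
  rw [← lintegral_neg_eq_self, (isStretch_S0 hc hd).lintegral_eq hm]
  refine lintegral_congr fun x => ?_
  rw [← curveY_eq, phiInv_curveY hc hd, ← ENNReal.ofReal_mul (by positivity)]

lemma base_energy_ne_top (hc : IsWaveSpeed c κ) (hd : IsWaveData u0 u1)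
    (hs : IsCharSolution c u0 u1 w z p q u) :
    (∫⁻ X, ENNReal.ofReal ((1 - Real.cos (w X (phi c u0 u1 X))) * p X (phi c u0 u1 X) / 8)) +
    (∫⁻ Y, ENNReal.ofReal ((1 - Real.cos (z (phiInv c u0 u1 Y) Y)) *
      q (phiInv c u0 u1 Y) Y / 8)) ≠ ⊤ := by
  have m1 : Measurable (Function.uncurry fun X Y => (1 - Real.cos (w X Y)) * p X Y / 8) :=
    ((measurable_const.sub (Real.measurable_cos.comp hs.measurable_w)).mul
      hs.measurable_p).div_const 8
  have m2 : Measurable (Function.uncurry fun X Y => (1 - Real.cos (z X Y)) * q X Y / 8) :=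
    ((measurable_const.sub (Real.measurable_cos.comp hs.measurable_z)).mul
      hs.measurable_q).div_const 8
  rw [lintegral_base_X hc hd m1, lintegral_base_Y hc hd m2, ENNReal.add_ne_top]
  constructor
  · have e : ∫⁻ x, ENNReal.ofReal ((1 + R0 c u0 u1 x ^ 2) *
        ((1 - Real.cos (w (curveX c u0 u1 x) (curveY c u0 u1 x))) *
          p (curveX c u0 u1 x) (curveY c u0 u1 x) / 8)) =
        ∫⁻ x, ENNReal.ofReal (R0 c u0 u1 x ^ 2 / 4) := by
      refine lintegral_congr_ae ?_
      filter_upwards [base_values_w hc hd hs] with x hx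
      rw [hx.1, hx.2]
      congr 1
      linarith [one_sub_cos_two_arctan (R0 c u0 u1 x)]
    rw [e]
    exact ((memLp_R0 hc hd).integrable_sq.div_const 4).lintegral_lt_top.ne
  · have e : ∫⁻ x, ENNReal.ofReal ((1 + S0 c u0 u1 x ^ 2) *
        ((1 - Real.cos (z (curveX c u0 u1 x) (curveY c u0 u1 x))) *
          q (curveX c u0 u1 x) (curveY c u0 u1 x) / 8)) =
        ∫⁻ x, ENNReal.ofReal (S0 c u0 u1 x ^ 2 / 4) := by
      refine lintegral_congr_ae ?_
      filter_upwards [base_values_z hc hd hs] with x hx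
      rw [hx.1, hx.2]
      congr 1
      linarith [one_sub_cos_two_arctan (S0 c u0 u1 x)]
    rw [e]
    exact ((memLp_S0 hc hd).integrable_sq.div_const 4).lintegral_lt_top.ne

/-- The solution as a characteristic system over the curve `γ`. -/
noncomputable def charSystem (hc : IsWaveSpeed c κ) (hd : IsWaveData u0 u1)
    (hs : IsCharSolution c u0 u1 w z p q u) : CharSystem where
  c := c
  κ := κ
  k₀ := sSup (range fun v => |deriv c v / (4 * c v ^ 2)|)
  E := ((∫⁻ X, ENNReal.ofReal ((1 - Real.cos (w X (phi c u0 u1 X))) *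
      p X (phi c u0 u1 X) / 8)) +
    (∫⁻ Y, ENNReal.ofReal ((1 - Real.cos (z (phiInv c u0 u1 Y) Y)) *
      q (phiInv c u0 u1 Y) Y / 8))).toReal
  φ := phi c u0 u1
  ψ := phiInv c u0 u1
  w := w
  z := z
  p := p
  q := q
  u := u
  contDiff_c := hc.smooth
  κ_pos := zero_lt_one.trans hc.one_lt
  E_nonneg := ENNReal.toReal_nonneg
  c_ge := hc.lower
  c_le := hc.upper
  k_le v := by
    refine le_trans ?_ (le_csSup hc.bdd (mem_range_self v))
    have := hc.pos v
    rw [abs_div, abs_div, abs_of_pos (show 0 < 8 * c v ^ 2 by positivity),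
      abs_of_pos (show 0 < 4 * c v ^ 2 by positivity)]
    gcongr
    norm_num
  lt_iff := phi_lt_iff hc hd
  gt_iff := lt_phi_iff hc hd
  measurable_w := hs.measurable_w
  measurable_z := hs.measurable_z
  measurable_p := hs.measurable_p
  measurable_q := hs.measurable_q
  continuous_u := hs.continuous_u
  locBdd_p r := (hs.locally_bounded r).imp fun _ h X hX Y hY => (h X hX Y hY).1
  locBdd_q r := (hs.locally_bounded r).imp fun _ h X hX Y hY => (h X hX Y hY).2
  eq_w := by
    filter_upwards [hs.eq_w] with X hX Y
    have h0 := hX (phi c u0 u1 X)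
    rw [intervalIntegral.integral_same, add_zero] at h0
    rw [h0]
    exact hX Y
  eq_z := by
    filter_upwards [hs.eq_z] with Y hY X
    have h0 := hY (phiInv c u0 u1 Y)
    rw [intervalIntegral.integral_same, add_zero] at h0
    rw [h0]
    exact hY X
  eq_p := hs.eq_p
  eq_q := hs.eq_q
  eq_u_Y X Y := by
    have h0 := hs.eq_u_Y X (phi c u0 u1 X)
    rw [intervalIntegral.integral_same, add_zero] at h0
    rw [h0]
    exact hs.eq_u_Y X Y
  eq_u_X X Y := by
    have h0 := hs.eq_u_X (phiInv c u0 u1 Y) Y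
    rw [intervalIntegral.integral_same, add_zero] at h0
    rw [h0]
    exact hs.eq_u_X X Y
  base_energy := (ENNReal.ofReal_toReal (base_energy_ne_top hc hd hs)).ge
  base_time X Y := by
    have mc : Measurable (Function.uncurry fun X Y => c (u X Y)) :=
      hc.smooth.continuous.measurable.comp hs.continuous_u.measurable
    have m1 : Measurable (Function.uncurry fun X Y =>
        (1 + Real.cos (w X Y)) * p X Y / (4 * c (u X Y))) :=
      ((measurable_const.add (Real.measurable_cos.comp hs.measurable_w)).mul
        hs.measurable_p).div (mc.const_mul 4)
    have m2 : Measurable (Function.uncurry fun X Y =>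
        (1 + Real.cos (z X Y)) * q X Y / (4 * c (u X Y))) :=
      ((measurable_const.add (Real.measurable_cos.comp hs.measurable_z)).mul
        hs.measurable_q).div (mc.const_mul 4)
    rw [integral_base_X hc hd m1, integral_base_Y hc hd m2]
    refine intervalIntegral.integral_congr_ae ?_
    filter_upwards [base_values_w hc hd hs, base_values_z hc hd hs] with x hx hx' _
    rw [hx.1, hx.2, hx'.1, hx'.2, mul_one, mul_one, ← mul_div_assoc, ← mul_div_assoc,
      one_add_cos_two_arctan, one_add_cos_two_arctan]

/-- The position is obtained by integrating `x_X = (1 + cos w) p / 4` as well. -/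
lemma posOf_eq (hc : IsWaveSpeed c κ) (hd : IsWaveData u0 u1)
    (hs : IsCharSolution c u0 u1 w z p q u) (X Y : ℝ) :
    posOf c u0 u1 z q X Y = footY c u0 u1 Y +
      ∫ X' in (phiInv c u0 u1 Y)..X, (1 + Real.cos (w X' Y)) * p X' Y / 4 := by
  have h := (charSystem hc hd hs).pos_closed X Y
  have mw : Measurable (Function.uncurry fun X Y => (1 + Real.cos (w X Y)) * p X Y / 4) :=
    (charSystem hc hd hs).measurable_xX
  have mz : Measurable (Function.uncurry fun X Y => (1 + Real.cos (z X Y)) * q X Y / 4) :=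
    (charSystem hc hd hs).measurable_xY
  have hX : ∫ X' in (phiInv c u0 u1 Y)..X,
      (1 + Real.cos (w X' (phi c u0 u1 X'))) * p X' (phi c u0 u1 X') / 4 =
      (footX c u0 u1 X - footY c u0 u1 Y) / 2 := by
    rw [integral_base_X hc hd mw]
    have : ∫ _ in (footY c u0 u1 Y)..(footX c u0 u1 X), (1 / 2 : ℝ) =
      (footX c u0 u1 X - footY c u0 u1 Y) / 2 := by simp; ring
    rw [← this]
    refine intervalIntegral.integral_congr_ae ?_
    filter_upwards [base_values_w hc hd hs] with x hx _
    rw [hx.1, hx.2]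
    linarith [one_add_cos_two_arctan (R0 c u0 u1 x)]
  have hY : ∫ Y' in (phi c u0 u1 X)..Y,
      (1 + Real.cos (z (phiInv c u0 u1 Y') Y')) * q (phiInv c u0 u1 Y') Y' / 4 =
      (footX c u0 u1 X - footY c u0 u1 Y) / 2 := by
    rw [integral_base_Y hc hd mz]
    have : ∫ _ in (footY c u0 u1 Y)..(footX c u0 u1 X), (1 / 2 : ℝ) =
      (footX c u0 u1 X - footY c u0 u1 Y) / 2 := by simp; ring
    rw [← this]
    refine intervalIntegral.integral_congr_ae ?_
    filter_upwards [base_values_z hc hd hs] with x hx _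
    rw [hx.1, hx.2]
    linarith [one_add_cos_two_arctan (S0 c u0 u1 x)]
  have h' : (∫ X' in (phiInv c u0 u1 Y)..X, (1 + Real.cos (w X' Y)) * p X' Y / 4) +
      (∫ Y' in (phi c u0 u1 X)..Y, (1 + Real.cos (z X Y')) * q X Y' / 4) =
      (∫ X' in (phiInv c u0 u1 Y)..X,
        (1 + Real.cos (w X' (phi c u0 u1 X'))) * p X' (phi c u0 u1 X') / 4) +
      ∫ Y' in (phi c u0 u1 X)..Y,
        (1 + Real.cos (z (phiInv c u0 u1 Y') Y')) * q (phiInv c u0 u1 Y') Y' / 4 := h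
  rw [posOf]
  linarith

end Concrete

/-! ### The order of positions along a curve of constant time -/

namespace CharSystem

variable (S : CharSystem)

lemma xX_eq (X Y : ℝ) : S.xX X Y = S.c (S.u X Y) * S.α X Y := by
  have := (S.c_pos (S.u X Y)).ne'
  rw [xX, α]
  field_simp

lemma xX_nonneg : ∀ᵐ X, ∀ Y, 0 ≤ S.xX X Y := by
  filter_upwards [S.α_nonneg] with X hX Y
  rw [xX_eq]
  exact mul_nonneg (S.c_pos _).le (hX Y)

lemma xY_nonneg : ∀ᵐ Y, ∀ X, 0 ≤ S.xY X Y := S.swap.xX_nonneg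

/-- As `x_X = c t_X`, the position increases along a horizontal segment at least as much as the
time does, up to the constant `κ⁻¹`. -/
lemma sub_T_le_integral_xX {X X' : ℝ} (h : X ≤ X') (Y : ℝ) :
    S.κ⁻¹ * (S.T X' Y - S.T X Y) ≤ ∫ r in X..X', S.xX r Y := by
  rw [(S.isPrimitive_T' Y).sub_eq, ← intervalIntegral.integral_const_mul]
  refine intervalIntegral.integral_mono_ae h
    ((S.locBdd_α.intervalIntegrable_left S.measurable_α _ _ _).const_mul _)
    (S.locBdd_xX.intervalIntegrable_left S.measurable_xX _ _ _) ?_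
  filter_upwards [S.α_nonneg] with r hr
  rw [xX_eq]
  exact mul_le_mul_of_nonneg_right (S.c_ge _) (hr Y)

end CharSystem

section Concrete

variable {c u0 u1 : ℝ → ℝ} {κ : ℝ} {w z p q u : ℝ → ℝ → ℝ}

lemma posOf_sub_right (hc : IsWaveSpeed c κ) (hd : IsWaveData u0 u1)
    (hs : IsCharSolution c u0 u1 w z p q u) (X Y Y' : ℝ) :
    posOf c u0 u1 z q X Y - posOf c u0 u1 z q X Y' =
      ∫ r in Y..Y', (charSystem hc hd hs).xY X r := by
  set S := charSystem hc hd hs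
  have hi := S.locBdd_xY.intervalIntegrable_right S.measurable_xY X
  have h := intervalIntegral.integral_interval_sub_left (hi (S.φ X) Y') (hi (S.φ X) Y)
  rw [← h]
  change footX c u0 u1 X - (∫ r in (S.φ X)..Y, S.xY X r) -
    (footX c u0 u1 X - ∫ r in (S.φ X)..Y', S.xY X r) = _
  ring

lemma posOf_sub_left (hc : IsWaveSpeed c κ) (hd : IsWaveData u0 u1)
    (hs : IsCharSolution c u0 u1 w z p q u) (X X' Y : ℝ) :
    posOf c u0 u1 z q X' Y - posOf c u0 u1 z q X Y =
      ∫ r in X..X', (charSystem hc hd hs).xX r Y := by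
  rw [posOf_eq hc hd hs, posOf_eq hc hd hs]
  set S := charSystem hc hd hs
  have hi := fun a b => S.locBdd_xX.intervalIntegrable_left S.measurable_xX Y a b
  have h := intervalIntegral.integral_interval_sub_left (hi (S.ψ Y) X') (hi (S.ψ Y) X)
  rw [← h]
  change footY c u0 u1 Y + (∫ r in (S.ψ Y)..X', S.xX r Y) -
    (footY c u0 u1 Y + ∫ r in (S.ψ Y)..X, S.xX r Y) = _
  ring

lemma antitone_posOf (hc : IsWaveSpeed c κ) (hd : IsWaveData u0 u1)
    (hs : IsCharSolution c u0 u1 w z p q u) (X : ℝ) : Antitone (posOf c u0 u1 z q X) := by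
  intro Y Y' h
  rw [← sub_nonneg, posOf_sub_right hc hd hs]
  refine intervalIntegral.integral_nonneg_of_ae h ?_
  filter_upwards [(charSystem hc hd hs).xY_nonneg] with r hr using hr X

lemma monotone_posOf (hc : IsWaveSpeed c κ) (hd : IsWaveData u0 u1)
    (hs : IsCharSolution c u0 u1 w z p q u) (Y : ℝ) :
    Monotone fun X => posOf c u0 u1 z q X Y := by
  intro X X' h
  simp only
  rw [← sub_nonneg, posOf_sub_left hc hd hs]
  refine intervalIntegral.integral_nonneg_of_ae h ?_
  filter_upwards [(charSystem hc hd hs).xX_nonneg] with r hr using hr Y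

lemma posOf_lt_of_T_lt (hc : IsWaveSpeed c κ) (hd : IsWaveData u0 u1)
    (hs : IsCharSolution c u0 u1 w z p q u) {X X' Y : ℝ} (h : X ≤ X')
    (hT : (charSystem hc hd hs).T X Y < (charSystem hc hd hs).T X' Y) :
    posOf c u0 u1 z q X Y < posOf c u0 u1 z q X' Y := by
  rw [← sub_pos, posOf_sub_left hc hd hs]
  exact (mul_pos (inv_pos.2 (charSystem hc hd hs).κ_pos) (sub_pos.2 hT)).trans_le
    ((charSystem hc hd hs).sub_T_le_integral_xX h Y)

/-- A backward wave of label `X` lies, at time `τ`, to the right of the forward wave of label `Y`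
exactly when the two have not met yet, i.e. when the point `(X, Y)` has a time beyond `τ`. -/
lemma posOf_right_lt_posOf_top_iff (hc : IsWaveSpeed c κ) (hd : IsWaveData u0 u1)
    (hs : IsCharSolution c u0 u1 w z p q u) (τ X Y : ℝ) :
    posOf c u0 u1 z q ((charSystem hc hd hs).right τ Y) Y <
      posOf c u0 u1 z q X ((charSystem hc hd hs).top τ X) ↔
    τ < (charSystem hc hd hs).T X Y := by
  set S := charSystem hc hd hs with hS
  constructor
  · intro h
    by_contra! hT
    exact absurd h (not_lt.2 ((antitone_posOf hc hd hs X ((S.le_top_iff τ X Y).2 hT)).trans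
      (monotone_posOf hc hd hs Y ((S.le_right_iff τ X Y).2 hT))))
  · intro hT
    refine (posOf_lt_of_T_lt hc hd hs ((S.right_lt_iff τ X Y).2 hT).le ?_).trans_le
      (antitone_posOf hc hd hs X ((S.top_lt_iff τ X Y).2 hT).le)
    rwa [← hS, S.T_right]

lemma monotone_posOf_top (hc : IsWaveSpeed c κ) (hd : IsWaveData u0 u1)
    (hs : IsCharSolution c u0 u1 w z p q u) (τ : ℝ) :
    Monotone fun X => posOf c u0 u1 z q X ((charSystem hc hd hs).top τ X) := fun _ X' h =>
  (monotone_posOf hc hd hs _ h).trans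
    (antitone_posOf hc hd hs X' ((charSystem hc hd hs).antitone_top τ h))

lemma antitone_posOf_right (hc : IsWaveSpeed c κ) (hd : IsWaveData u0 u1)
    (hs : IsCharSolution c u0 u1 w z p q u) (τ : ℝ) :
    Antitone fun Y => posOf c u0 u1 z q ((charSystem hc hd hs).right τ Y) Y := fun Y _' h =>
  (antitone_posOf hc hd hs _ h).trans
    (monotone_posOf hc hd hs Y ((charSystem hc hd hs).antitone_right τ h))

lemma interactionPotential_eq (hc : IsWaveSpeed c κ) (hd : IsWaveData u0 u1)
    (hs : IsCharSolution c u0 u1 w z p q u) (τ : ℝ) :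
    interactionPotential c u0 u1 w z p q u τ = (charSystem hc hd hs).potential τ := by
  set S := charSystem hc hd hs with hS
  have e1 : muMinus c u0 u1 w z p q u τ =
      (volume.withDensity fun X => ENNReal.ofReal (S.F X (S.top τ X))).map
        fun X => posOf c u0 u1 z q X (S.top τ X) := rfl
  have e2 : muPlus c u0 u1 z q u τ =
      (volume.withDensity fun Y => ENNReal.ofReal (S.G (S.right τ Y) Y)).map
        fun Y => posOf c u0 u1 z q (S.right τ Y) Y := rfl
  have m1 := (monotone_posOf_top hc hd hs τ).measurable
  have m2 := (antitone_posOf_right hc hd hs τ).measurable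
  rw [← hS] at m1 m2
  have e3 : Prod.map (fun X => posOf c u0 u1 z q X (S.top τ X))
      (fun Y => posOf c u0 u1 z q (S.right τ Y) Y) ⁻¹' {P : ℝ × ℝ | P.1 > P.2} =
      {P | τ < S.T P.1 P.2} := by
    ext P
    exact posOf_right_lt_posOf_top_iff hc hd hs τ P.1 P.2
  rw [interactionPotential, e1, e2, Measure.map_prod_map _ _ m1 m2,
    Measure.map_apply (m1.prodMap m2) (measurableSet_lt measurable_snd measurable_fst), e3,
    prod_withDensity (S.measurable_F_top τ) (S.measurable_G_right τ),
    withDensity_apply _ (S.measurableSet_lt_T τ)]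
  rfl

end Concrete

/-! ### Functions whose increments are bounded above linearly -/

lemma eVariationOn_sub_le (f g : ℝ → ℝ) (s : Set ℝ) :
    eVariationOn (fun x => f x - g x) s ≤ eVariationOn f s + eVariationOn g s := by
  refine iSup_le fun P => ?_
  calc ∑ i ∈ Finset.range P.1, edist (f (P.2.1 (i + 1)) - g (P.2.1 (i + 1)))
        (f (P.2.1 i) - g (P.2.1 i))
      ≤ ∑ i ∈ Finset.range P.1, (edist (f (P.2.1 (i + 1))) (f (P.2.1 i)) +
        edist (g (P.2.1 (i + 1))) (g (P.2.1 i))) :=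
      Finset.sum_le_sum fun i _ => by
        simp only [sub_eq_add_neg]
        exact (edist_add_add_le _ _ _ _).trans (by rw [edist_neg_neg])
    _ ≤ _ := by
      rw [Finset.sum_add_distrib]
      exact add_le_add (eVariationOn.sum_le P.2.2.1 P.2.2.2)
        (eVariationOn.sum_le P.2.2.1 P.2.2.2)

/-- If `f(t) - f(s) ≤ L (t - s)` for `s ≤ t`, then `f` is the difference of the nondecreasing
functions `L t` and `L t - f(t)`. -/
lemma locallyBoundedVariationOn_of_sub_le {f : ℝ → ℝ} {L : ℝ} (hL : 0 ≤ L)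
    (h : ∀ s t, s ≤ t → f t - f s ≤ L * (t - s)) : LocallyBoundedVariationOn f univ := by
  intro a b ha hb
  have h1 : MonotoneOn (fun t => L * t) univ := fun s _ t _ hst =>
    mul_le_mul_of_nonneg_left hst hL
  have h2 : MonotoneOn (fun t => L * t - f t) univ := fun s _ t _ hst => by
    have := h s t hst
    simp only
    linarith
  have e : f = fun t => L * t - (L * t - f t) := by
    funext t
    ring
  rw [e]
  exact ((eVariationOn_sub_le _ _ _).trans_lt (ENNReal.add_lt_top.2
    ⟨(h1.locallyBoundedVariationOn a b ha hb).lt_top,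
      (h2.locallyBoundedVariationOn a b ha hb).lt_top⟩)).ne

end VariationalWave

theorem lemma1 (c u0 u1 : ℝ → ℝ) (κ : ℝ)
    (hc : VariationalWave.IsWaveSpeed c κ) (hdata : VariationalWave.IsWaveData u0 u1)
    (w z p q u : ℝ → ℝ → ℝ)
    (hsol : VariationalWave.IsCharSolution c u0 u1 w z p q u) :
    (∀ t : ℝ, VariationalWave.interactionPotential c u0 u1 w z p q u t ≠ ⊤) ∧
    LocallyBoundedVariationOn
      (fun t : ℝ => (VariationalWave.interactionPotential c u0 u1 w z p q u t).toReal)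
      Set.univ ∧
    ∃ L₀ : ℝ, ∀ s t : ℝ, s < t →
      (VariationalWave.interactionPotential c u0 u1 w z p q u t).toReal -
        (VariationalWave.interactionPotential c u0 u1 w z p q u s).toReal ≤ L₀ * (t - s) := by
  simp only [VariationalWave.interactionPotential_eq hc hdata hsol]
  obtain ⟨L, hL, h⟩ :=
    (VariationalWave.charSystem hc hdata hsol).exists_toReal_potential_sub_le
  exact ⟨(VariationalWave.charSystem hc hdata hsol).potential_ne_top,
    VariationalWave.locallyBoundedVariationOn_of_sub_le hL h, L, fun s t hst => h s t hst.le⟩
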